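/- Let $m\ge 0$ and let $\gamma^0,\dots,\gamma^3\in M_4(\mathbb C)$ be Dirac matrices: $\gamma^\mu\gamma^\nu+\gamma^\nu\gamma^\mu=-2g^{\mu\nu}$ with $g=\mathrm{diag}(-1,1,1,1)$, $\gamma^{0*}=\gamma^0$, $\gamma^{i*}=-\gamma^i$; put $\beta=\gamma^0$. Let $J=\{x\in\mathbb R^{1,3}: -(x^0)^2+|\vec x|^2\le 0\}$ and $J(\mathcal O)=\mathcal O+J$. A function on $\mathbb R^{1,3}$ is space-compact if its support is contained in $J(K)$ for some compact $K$. Let $\mathcal W_{\rm D}$ be the space of smooth space-compact $\zeta:\mathbb R^{1,3}\to\mathbb C^4$ with $(-i\gamma^\mu\partial_\mu+m)\zeta=0$. Let $S=(i\gamma^\mu\partial_\mu+m)D$, where $D$ is the Pauli--Jordan distribution $$D(t,\vec x)=\int_{\mathbb R^3}\frac{d\vec k}{(2\pi)^3\sqrt{\vec k^2+m^2}}\,e^{i\vec k\cdot\vec x}\sin\bigl(t\sqrt{\vec k^2+m^2}\bigr),$$ and for $f\in C_c^\infty(\mathbb R^{1,3},\mathbb C^4)$ let $S*f(x)=\int S(x-y)f(y)\,dy$.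 For $\zeta_1,\zeta_2\in\mathcal W_{\rm D}$ let $\overline{\zeta_1}\cdot\zeta_2=\int_{\mathcal S}\overline{\zeta_1(x)}\beta\gamma^\mu\zeta_2(x)\,ds_\mu(x)$, where $\mathcal S$ is a smooth spacelike Cauchy hypersurface; for $\mathcal S=\{x^0=t\}$ this is $\int\overline{\zeta_1(t,\vec x)}\zeta_2(t,\vec x)\,d\vec x$. (Here $\overline{u}v=\sum_a\overline{u_a}v_a$ for $u,v\in\mathbb C^4$.) (A) For every $\vartheta\in C_c^\infty(\mathbb R^3,\mathbb C^4)$ there is a unique $\zeta\in\mathcal W_{\rm D}$ with $\zeta(0,\vec x)=\vartheta(\vec x)$. It satisfies $\operatorname{supp}\zeta\subset J(\{0\}\times\operatorname{supp}\vartheta)$ and $$\zeta(t,\vec x)=-i\int_{\mathbb R^3}S(t,\vec x-\vec y)\beta\vartheta(\vec y)\,d\vec y .$$ (B) (1) For every $f\in C_c^\infty(\mathbb R^{1,3},\mathbb C^4)$, $S*f\in\mathcal W_{\rm D}$. (2) Every element of $\mathcal W_{\rm D}$ is of this form. (3) For all $f_1,f_2\in C_c^\infty(\mathbb R^{1,3},\mathbb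 C^4)$ and for every such hypersurface $\mathcal S$, $$\overline{S*f_1}\cdot S*f_2=-i\iint\overline{f_1(x)}\,\beta S(x-y)f_2(y)\,dx\,dy .$$ (4) If $J(\operatorname{supp}f_1)\cap\operatorname{supp}f_2=\emptyset$, then $\overline{S*f_1}\cdot S*f_2=0$. -/

import Mathlib

open scoped ContDiff Matrix Pointwise

noncomputable section

namespace DiracCauchy

/-! ### Minkowski space, signature `(-+++)`, coordinates `x = (x⁰, x⃗)` -/

abbrev Space := EuclideanSpace ℝ (Fin 3)

abbrev Spacetime := ℝ × Space

abbrev Spinor := Fin 4 → ℂ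

/-- The diagonal metric `g = diag(-1, 1, 1, 1)` (equal to its inverse). -/
def metric : Matrix (Fin 4) (Fin 4) ℂ := Matrix.diagonal ![-1, 1, 1, 1]

/-- `x_μ x^μ`. -/
def minkowskiSq (x : Spacetime) : ℝ := -x.1 ^ 2 + ‖x.2‖ ^ 2

/-- The full (future and past, closed) light cone; it contains `0`. -/
def lightCone : Set Spacetime := {x | minkowskiSq x ≤ 0}

/-- The causal shadow `J(O) = O + J`. -/
def causalShadow (O : Set Spacetime) : Set Spacetime := O + lightCone

def SpatiallySeparated (A B : Set Spacetime) : Prop := Disjoint (causalShadow A) B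

def IsSpaceCompact (f : Spacetime → Spinor) : Prop :=
  ∃ K : Set Spacetime, IsCompact K ∧ tsupport f ⊆ causalShadow K

/-- The partial derivative `∂_i` on `ℝ³`. -/
def spacePartial {E : Type*} [NormedAddCommGroup E] [NormedSpace ℝ E]
    (i : Fin 3) (f : Space → E) (x : Space) : E :=
  fderiv ℝ f x (EuclideanSpace.single i 1)

/-- The coordinate basis vectors of `ℝ^{1,3}`. -/
def basisVec : Fin 4 → Spacetime :=
  Fin.cons (1, 0) (fun i : Fin 3 => (0, EuclideanSpace.single i 1))

/-- The partial derivative `∂_μ` on `ℝ^{1,3}`. -/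
def partialDeriv {E : Type*} [NormedAddCommGroup E] [NormedSpace ℝ E]
    (μ : Fin 4) (f : Spacetime → E) (x : Spacetime) : E :=
  fderiv ℝ f x (basisVec μ)

/-! ### Dirac matrices and the Dirac equation -/

/-- `[γ^μ, γ^ν]_+ = -2 g^{μν}`, `γ^{0*} = γ^0`, `γ^{i*} = -γ^i`. -/
structure IsDiracMatrices (γ : Fin 4 → Matrix (Fin 4) (Fin 4) ℂ) : Prop where
  anticomm : ∀ μ ν, γ μ * γ ν + γ ν * γ μ =
    (-2 * metric μ ν) • (1 : Matrix (Fin 4) (Fin 4) ℂ)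
  herm_zero : (γ 0)ᴴ = γ 0
  herm_succ : ∀ i : Fin 3, (γ i.succ)ᴴ = -γ i.succ

/-- `(-i γ^μ ∂_μ + m) ζ`. -/
def diracOp (γ : Fin 4 → Matrix (Fin 4) (Fin 4) ℂ) (m : ℝ)
    (ζ : Spacetime → Spinor) (x : Spacetime) : Spinor :=
  (-Complex.I) • ∑ μ, γ μ *ᵥ partialDeriv μ ζ x + (m : ℂ) • ζ x

/-- The space `W_D` of smooth space-compact solutions of the Dirac equation. -/
def diracSolutions (γ : Fin 4 → Matrix (Fin 4) (Fin 4) ℂ) (m : ℝ) :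
    Set (Spacetime → Spinor) :=
  {ζ | ContDiff ℝ ∞ ζ ∧ IsSpaceCompact ζ ∧ ∀ x, diracOp γ m ζ x = 0}

/-! ### The Pauli-Jordan function and the Dirac propagator `S`

Both are distributions on `ℝ^{1,3}` that are smooth in time, so they are given by the families of
distributions `D(t, ·)`, `S(t, ·)` on `ℝ³`, described by their values on (vector-valued) test
functions. -/

def energy (m : ℝ) (k : Space) : ℝ := Real.sqrt (‖k‖ ^ 2 + m ^ 2)

/-- `∫ D(t, x) φ(x) dx` for
`D(t, x) = ∫ e^{i k·x} sin(t √(k² + m²)) / ((2π)³ √(k² + m²)) dk`;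
as usual for an oscillatory integral, the test function is integrated first. -/
def pauliJordan (m t : ℝ) (φ : Space → Spinor) : Spinor :=
  ∫ k : Space, ((Real.sin (t * energy m k) / ((2 * Real.pi) ^ 3 * energy m k) : ℝ) : ℂ) •
    ∫ x : Space, Complex.exp (Complex.I * ((inner ℝ k x : ℝ) : ℂ)) • φ x

/-- `∫ S(t, x) φ(x) dx` for `S = (i γ^μ ∂_μ + m) D`: the time derivative acts on the family
`t ↦ D(t, ·)`, the spatial derivatives are distributional. -/
def propagator (γ : Fin 4 → Matrix (Fin 4) (Fin 4) ℂ) (m t : ℝ) (φ : Space → Spinor) : Spinor :=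
  Complex.I • (γ 0 *ᵥ deriv (fun s => pauliJordan m s φ) t
      + ∑ i : Fin 3, γ i.succ *ᵥ (-pauliJordan m t (spacePartial i φ)))
    + (m : ℂ) • pauliJordan m t φ

/-- `∫ S(t, x - y) φ(y) dy`, the convolution on `ℝ³`. -/
def propagatorSpaceConv (γ : Fin 4 → Matrix (Fin 4) (Fin 4) ℂ) (m t : ℝ)
    (φ : Space → Spinor) (x : Space) : Spinor :=
  propagator γ m t (fun z => φ (x - z))

/-- `(S * f)(x) = ∫ S(x - y) f(y) dy`, the convolution on `ℝ^{1,3}`. -/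
def propagatorConv (γ : Fin 4 → Matrix (Fin 4) (Fin 4) ℂ) (m : ℝ)
    (f : Spacetime → Spinor) (x : Spacetime) : Spinor :=
  ∫ s : ℝ, propagatorSpaceConv γ m (x.1 - s) (fun y => f (s, y)) x.2

/-! ### The scalar product on `W_D` -/

/-- The current `j^μ(ζ₁, ζ₂, x) = conj(ζ₁(x)) β γ^μ ζ₂(x)`, where `β = γ^0`. -/
def current (γ : Fin 4 → Matrix (Fin 4) (Fin 4) ℂ) (ζ₁ ζ₂ : Spacetime → Spinor)
    (μ : Fin 4) (x : Spacetime) : ℂ :=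
  star (ζ₁ x) ⬝ᵥ ((γ 0 * γ μ) *ᵥ ζ₂ x)

/-- The graph `{(h(x), x)}` is a smooth spacelike Cauchy hypersurface: every inextendible causal
curve (these are the graphs of the `1`-Lipschitz maps `ℝ → ℝ³`) meets it exactly once.
Every smooth spacelike Cauchy hypersurface of Minkowski space is such a graph. -/
structure IsCauchyHypersurface (h : Space → ℝ) : Prop where
  smooth : ContDiff ℝ ∞ h
  spacelike : ∀ x, ‖fderiv ℝ h x‖ < 1
  meets : ∀ c : ℝ → Space, LipschitzWith 1 c → ∃! t : ℝ, h (c t) = t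

/-- The density with respect to `dx` of `j^μ ds_μ` on the graph of `h`. -/
def fluxDensity (γ : Fin 4 → Matrix (Fin 4) (Fin 4) ℂ) (h : Space → ℝ)
    (ζ₁ ζ₂ : Spacetime → Spinor) (x : Space) : ℂ :=
  current γ ζ₁ ζ₂ 0 (h x, x)
    - ∑ i : Fin 3, ((spacePartial i h x : ℝ) : ℂ) * current γ ζ₁ ζ₂ i.succ (h x, x)

/-- `conj(ζ₁) · ζ₂ = ∫_𝒮 j^μ(ζ₁, ζ₂, x) ds_μ(x)`, where `𝒮` is the graph of `h`. -/
def scalarProduct (γ : Fin 4 → Matrix (Fin 4) (Fin 4) ℂ) (h : Space → ℝ)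
    (ζ₁ ζ₂ : Spacetime → Spinor) : ℂ :=
  ∫ x : Space, fluxDensity γ h ζ₁ ζ₂ x

end DiracCauchy

end

/-! On the Fourier side the propagator at time t is multiplication by i cos(tω) γ⁰ + (sin(tω)/ω)(m −
γ^i k_i), where ω² = |k|² + m². Writing cosine and sine as exponentials turns it into plane waves of
sign σ = ±1 with phase k·x − σωt and amplitude `waveMatrix`. The Clifford relations make the symbol
of the Dirac operator annihilate this amplitude (`IsDiracMatrices.dispersion`). For a test source f
the amplitudes decay rapidly in k, so their superpositions are smooth solutions
(`HasMoments.contDiff`, `HasMoments.diracOp_eq_zero`). The field `waveField` covers two cases at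
once: for `Measure.dirac s` it is S(t − s, ·) convolved with f(s, ·), and for `volume` it is S * f,
the integral over s of the former. By Fourier inversion the field emitted at time s takes the value
iγ⁰f(s, ·) at time s (`waveField_dirac_self`).

Uniqueness and supports come from an energy estimate. The current satisfies j⁰ + n_i j^i ≥ 0 for |n|
≤ 1, so the integral of j⁰ against a weight that decreases along causal directions cannot grow
(`IsDiracMatrices.eq_zero_of_forward_cone`). Hence a solution is determined by its values at one
time and lives in the causal shadow of their support. This settles the Cauchy problem, with solution
−iS(t)βϑ, and shows that S * f is space-compact.

Surjectivity: choose χ(t) with integral 1 and compact support, and put f = −iχβζ. The field emitted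
at time s has value χ(s)ζ at time s, hence equals χ(s)ζ everywhere by uniqueness, and integration
over s returns ζ.

Scalar products: the current is conserved, so the flux is the same through every graph that meets
the region |x| ≤ |t| + C in a bounded set, for all C, and Cauchy hypersurfaces are such graphs. The
product of the field emitted by f₁ at time s with S * f₂ may therefore be computed on the slice x⁰ =
s, where the first factor is iβf₁(s, ·). Integration over s gives the formula. Its integrand lives
on supp f₁ ∩ J(supp f₂), which is empty for spatially separated supports because J = −J. -/

noncomputable section

namespace DiracCauchy

open MeasureTheory Filter Topology

/-! ### Oscillatory integrals -/

/-- The superposition `∫ exp(i θ_a(p)) g(a) dμ(a)` of plane waves. -/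
def planeWaves {α : Type*} [MeasurableSpace α] {E : Type*} [NormedAddCommGroup E] [NormedSpace ℝ E]
    [NormedSpace ℂ E] (μ : Measure α) (θ : α → Spacetime →L[ℝ] ℝ) (g : α → E) (p : Spacetime) : E :=
  ∫ a, Complex.exp (Complex.I * ((θ a p : ℝ) : ℂ)) • g a ∂μ

/-- All moments of the amplitude `g` with respect to the wave covector `θ` are finite. -/
structure HasMoments {α : Type*} [MeasurableSpace α] {E : Type*} [NormedAddCommGroup E]
    [NormedSpace ℝ E] (μ : Measure α) (θ : α → Spacetime →L[ℝ] ℝ) (g : α → E) : Prop where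
  phase : AEStronglyMeasurable θ μ
  moment : ∀ n : ℕ, Integrable (fun a => ‖θ a‖ ^ n • g a) μ

section

variable {α : Type*} [MeasurableSpace α] {E : Type*} [NormedAddCommGroup E] [NormedSpace ℝ E]
  {μ : Measure α} {θ : α → Spacetime →L[ℝ] ℝ}
  {g : α → E}

theorem norm_exp_I_mul (r : ℝ) : ‖Complex.exp (Complex.I * (r : ℂ))‖ = 1 := by
  rw [mul_comm]; exact Complex.norm_exp_ofReal_mul_I r

theorem aestronglyMeasurable_smulRight {w : α → E} (hθ : AEStronglyMeasurable θ μ)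
    (hw : AEStronglyMeasurable w μ) : AEStronglyMeasurable (fun a => (θ a).smulRight (w a)) μ := by
  have hc : Continuous fun z : (Spacetime →L[ℝ] ℝ) × E =>
      (z.1.smulRight z.2 : Spacetime →L[ℝ] E) := isBoundedBilinearMap_smulRight.continuous
  exact hc.comp_aestronglyMeasurable (hθ.prodMk hw)

theorem HasMoments.integrable (h : HasMoments μ θ g) : Integrable g μ := by
  simpa using h.moment 0

theorem HasMoments.aestronglyMeasurable_phase (h : HasMoments μ θ g) (p : Spacetime) :
    AEStronglyMeasurable (fun a => Complex.exp (Complex.I * ((θ a p : ℝ) : ℂ))) μ := by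
  have h1 : AEStronglyMeasurable (fun a => θ a p) μ :=
    (ContinuousLinearMap.apply ℝ ℝ p).continuous.comp_aestronglyMeasurable h.phase
  have h2 : Continuous fun r : ℝ => Complex.exp (Complex.I * (r : ℂ)) := by fun_prop
  exact h2.comp_aestronglyMeasurable h1

variable [NormedSpace ℂ E]

theorem HasMoments.integrable_wave (h : HasMoments μ θ g) (p : Spacetime) :
    Integrable (fun a => Complex.exp (Complex.I * ((θ a p : ℝ) : ℂ)) • g a) μ := by
  refine h.integrable.mono ((h.aestronglyMeasurable_phase p).smul
    h.integrable.aestronglyMeasurable) (Eventually.of_forall fun a => ?_)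
  rw [norm_smul, norm_exp_I_mul, one_mul]

/-- Since |θ(v)| ≤ ‖θ‖‖v‖, differentiating costs exactly one moment. The class of amplitudes is thus
closed under differentiation, which drives the induction for smoothness. -/
theorem HasMoments.directional (h : HasMoments μ θ g) (v : Spacetime) :
    HasMoments μ θ (fun a => (Complex.I * ((θ a v : ℝ) : ℂ)) • g a) := by
  refine ⟨h.phase, fun n => ?_⟩
  have h1 : AEStronglyMeasurable (fun a => θ a v) μ :=
    (ContinuousLinearMap.apply ℝ ℝ v).continuous.comp_aestronglyMeasurable h.phase
  have h2 : Continuous fun r : ℝ => Complex.I * (r : ℂ) := by fun_prop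
  refine ((h.moment (n + 1)).norm.const_mul ‖v‖).mono
    ((h.phase.norm.pow n).smul ((h2.comp_aestronglyMeasurable h1).smul
      h.integrable.aestronglyMeasurable)) (Eventually.of_forall fun a => ?_)
  simp only [norm_smul, norm_mul, norm_pow, norm_norm, Complex.norm_I, one_mul, Complex.norm_real]
  have := (θ a).le_opNorm v
  calc ‖θ a‖ ^ n * (‖θ a v‖ * ‖g a‖) ≤ ‖θ a‖ ^ n * ((‖θ a‖ * ‖v‖) * ‖g a‖) := by gcongr
    _ = _ := by ring

variable [IsScalarTower ℝ ℂ E]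

theorem real_smul_eq_coe_smul (r : ℝ) (x : E) : r • x = (r : ℂ) • x :=
  (algebraMap_smul ℂ r x).symm

/-- The phases have modulus one, so the first moment dominates the derivative uniformly in the
point. -/
theorem HasMoments.hasFDerivAt (h : HasMoments μ θ g) (p : Spacetime) :
    HasFDerivAt (planeWaves μ θ g)
      (∫ a, (θ a).smulRight ((Complex.exp (Complex.I * ((θ a p : ℝ) : ℂ)) * Complex.I) • g a) ∂μ)
      p := by
  refine hasFDerivAt_integral_of_dominated_of_fderiv_le
    (F := fun q a => Complex.exp (Complex.I * ((θ a q : ℝ) : ℂ)) • g a)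
    (F' := fun q a =>
      (θ a).smulRight ((Complex.exp (Complex.I * ((θ a q : ℝ) : ℂ)) * Complex.I) • g a))
    (s := Set.univ) (bound := fun a => ‖‖θ a‖ ^ 1 • g a‖) univ_mem
    (Eventually.of_forall fun q => (h.integrable_wave q).aestronglyMeasurable)
    (h.integrable_wave p) ?_ (Eventually.of_forall fun a q _ => ?_) (h.moment 1).norm
    (Eventually.of_forall fun a q _ => ?_)
  · exact aestronglyMeasurable_smulRight h.phase
      (((h.aestronglyMeasurable_phase p).mul aestronglyMeasurable_const).smul
        h.integrable.aestronglyMeasurable)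
  · rw [ContinuousLinearMap.norm_smulRight_apply, norm_smul, norm_mul, norm_exp_I_mul]
    simp [norm_smul]
  · have h1 : HasFDerivAt (fun q => ((θ a q : ℝ) : ℂ)) (Complex.ofRealCLM.comp (θ a)) q :=
      (Complex.ofRealCLM.comp (θ a)).hasFDerivAt
    have h2 := ((h1.const_mul Complex.I).cexp).smul_const (g a)
    convert h2 using 1
    refine ContinuousLinearMap.ext fun v => ?_
    simp only [ContinuousLinearMap.smulRight_apply, _root_.smul_apply,
      ContinuousLinearMap.comp_apply, Complex.ofRealCLM_apply, smul_eq_mul]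
    rw [real_smul_eq_coe_smul, smul_smul]
    congr 1
    ring

theorem HasMoments.fderiv_apply (h : HasMoments μ θ g) (p v : Spacetime) :
    fderiv ℝ (planeWaves μ θ g) p v =
      planeWaves μ θ (fun a => (Complex.I * ((θ a v : ℝ) : ℂ)) • g a) p := by
  rw [(h.hasFDerivAt p).fderiv, ContinuousLinearMap.integral_apply]
  · refine integral_congr_ae (Eventually.of_forall fun a => ?_)
    simp only [ContinuousLinearMap.smulRight_apply]
    rw [real_smul_eq_coe_smul, smul_smul, smul_smul]
    congr 1
    ring
  · refine (h.moment 1).mono (aestronglyMeasurable_smulRight h.phase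
      (((h.aestronglyMeasurable_phase p).mul aestronglyMeasurable_const).smul
        h.integrable.aestronglyMeasurable)) (Eventually.of_forall fun a => ?_)
    rw [ContinuousLinearMap.norm_smulRight_apply, norm_smul, norm_mul, norm_exp_I_mul]
    simp [norm_smul]

theorem HasMoments.contDiff (h : HasMoments μ θ g) : ContDiff ℝ ∞ (planeWaves μ θ g) := by
  rw [contDiff_infty]
  intro n
  induction n generalizing g with
  | zero =>
    exact contDiff_zero.2 (continuous_iff_continuousAt.2 fun p => (h.hasFDerivAt p).continuousAt)
  | succ n ih =>
    rw [Nat.cast_add, Nat.cast_one, contDiff_succ_iff_fderiv_apply]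
    refine ⟨fun p => (h.hasFDerivAt p).differentiableAt, by simp, fun v => ?_⟩
    rw [funext fun p => h.fderiv_apply p v]
    exact ih (h.directional v)

end

/-! ### Integrals of compactly supported functions -/

section

theorem hasCompactSupport_of_eq_zero_of_lt {X : Type*} [Zero X] {f : Space → X} {R : ℝ}
    (h : ∀ y, R < ‖y‖ → f y = 0) : HasCompactSupport f :=
  HasCompactSupport.intro (isCompact_closedBall 0 R) fun y hy =>
    h y (by simpa using hy)

theorem integrable_of_eq_zero_of_lt {E : Type*} [NormedAddCommGroup E] {f : Space → E} (hf : Continuous f) {R : ℝ}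
    (h : ∀ y, R < ‖y‖ → f y = 0) : Integrable f :=
  hf.integrable_of_hasCompactSupport (hasCompactSupport_of_eq_zero_of_lt h)

variable {E : Type*} [NormedAddCommGroup E] [NormedSpace ℝ E]

theorem hasDerivAt_slice {F : Spacetime → E} (hF : ContDiff ℝ 1 F) (t : ℝ) (y : Space) :
    HasDerivAt (fun s => F (s, y)) (fderiv ℝ F (t, y) (1, 0)) t := by
  have h1 : HasFDerivAt F (fderiv ℝ F (t, y)) (t, y) :=
    (hF.differentiable (by norm_num) _).hasFDerivAt
  exact h1.comp_hasDerivAt t ((hasDerivAt_id t).prodMk (hasDerivAt_const t y))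

/-- For times near `t₀` everything lives in one ball, and the maximum of the derivative over a
compact cylinder serves as an integrable majorant. -/
theorem hasDerivAt_integral_slice {F : Spacetime → E} (hF : ContDiff ℝ 1 F) {t₀ R : ℝ}
    (h : ∀ t ∈ Metric.ball t₀ 1, ∀ y, R < ‖y‖ → F (t, y) = 0) :
    HasDerivAt (fun t => ∫ y, F (t, y)) (∫ y, fderiv ℝ F (t₀, y) (1, 0)) t₀ := by
  have hd : Continuous fun p => fderiv ℝ F p (1, 0) := by
    have := hF.continuous_fderiv (by norm_num)
    fun_prop
  obtain ⟨C, hC⟩ := ((isCompact_closedBall t₀ 1).prod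
    (isCompact_closedBall (0 : Space) R)).exists_bound_of_continuousOn hd.continuousOn
  have hzero : ∀ t ∈ Metric.ball t₀ 1, ∀ y, R < ‖y‖ → fderiv ℝ F (t, y) (1, 0) = 0 := by
    intro t ht y hy
    have h1 : HasDerivAt (fun s => F (s, y)) 0 t :=
      (hasDerivAt_const t (0 : E)).congr_of_eventuallyEq
        (Filter.eventually_of_mem (Metric.isOpen_ball.mem_nhds ht) fun s hs => h s hs y hy)
    exact (hasDerivAt_slice hF t y).unique h1
  refine (hasDerivAt_integral_of_dominated_loc_of_deriv_le (F := fun t y => F (t, y))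
    (F' := fun t y => fderiv ℝ F (t, y) (1, 0))
    (bound := (Metric.closedBall (0 : Space) R).indicator fun _ => C)
    (Metric.ball_mem_nhds t₀ one_pos)
    (Eventually.of_forall fun t => ?_) ?_ ?_ (Eventually.of_forall fun y t ht => ?_) ?_
    (Eventually.of_forall fun y t _ => hasDerivAt_slice hF t y)).2
  · exact (hF.continuous.comp (by fun_prop : Continuous fun y : Space => (t, y))).aestronglyMeasurable
  · exact integrable_of_eq_zero_of_lt
      (hF.continuous.comp (by fun_prop : Continuous fun y : Space => (t₀, y)))
      (h t₀ (Metric.mem_ball_self one_pos))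
  · exact (hd.comp (by fun_prop : Continuous fun y : Space => (t₀, y))).aestronglyMeasurable
  · by_cases hy : R < ‖y‖
    · rw [hzero t ht y hy, norm_zero, Set.indicator_of_notMem]
      simpa using hy
    · have hy' : y ∈ Metric.closedBall (0 : Space) R := by simpa using hy
      rw [Set.indicator_of_mem hy']
      exact hC (t, y) ⟨Metric.ball_subset_closedBall ht, hy'⟩
  · exact (integrable_indicator_iff measurableSet_closedBall).2
      (integrableOn_const (measure_closedBall_lt_top).ne)

theorem integral_spacePartial_eq_zero {f : Space → ℂ} (hf : ContDiff ℝ 1 f)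
    (hc : HasCompactSupport f) (i : Fin 3) : ∫ x, spacePartial i f x = 0 := by
  have hd : Continuous fun x => fderiv ℝ f x (EuclideanSpace.single i 1) := by
    have := hf.continuous_fderiv (by norm_num)
    fun_prop
  have hi : Integrable fun x => fderiv ℝ f x (EuclideanSpace.single i 1) :=
    hd.integrable_of_hasCompactSupport (hc.fderiv_apply ℝ _)
  have := integral_mul_fderiv_eq_neg_fderiv_mul_of_integrable (μ := volume)
    (f := fun _ : Space => (1 : ℂ)) (g := f) (v := EuclideanSpace.single i 1) (𝕜 := ℂ)
    (by simp) (by simpa using hi)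
    (by simpa using hf.continuous.integrable_of_hasCompactSupport hc)
    (fun x _ => differentiableAt_const _) (fun x _ => hf.differentiable (by norm_num) x)
  simpa [spacePartial] using this

end

/-! ### Dirac algebra -/

/-- `γ^i k_i` for a spatial covector `k`. -/
def slash (γ : Fin 4 → Matrix (Fin 4) (Fin 4) ℂ) (k : Fin 3 → ℝ) : Matrix (Fin 4) (Fin 4) ℂ :=
  ∑ i, (k i : ℂ) • γ i.succ

section

variable {γ : Fin 4 → Matrix (Fin 4) (Fin 4) ℂ}

theorem IsDiracMatrices.zero_mul_zero (hγ : IsDiracMatrices γ) : γ 0 * γ 0 = 1 := by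
  have h := hγ.anticomm 0 0
  simp only [metric, Matrix.diagonal_apply_eq, Matrix.cons_val_zero] at h
  rw [← two_smul ℂ (γ 0 * γ 0)] at h
  have := congrArg (fun M => (2⁻¹ : ℂ) • M) h
  simpa [smul_smul] using this

theorem IsDiracMatrices.succ_mul_zero (hγ : IsDiracMatrices γ) (i : Fin 3) :
    γ i.succ * γ 0 = -(γ 0 * γ i.succ) := by
  have h := hγ.anticomm i.succ 0
  rw [metric, Matrix.diagonal_apply_ne _ (Fin.succ_ne_zero i)] at h
  simp only [mul_zero, zero_smul] at h
  exact eq_neg_of_add_eq_zero_left h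

theorem IsDiracMatrices.succ_anticomm (hγ : IsDiracMatrices γ) (i j : Fin 3) :
    γ i.succ * γ j.succ + γ j.succ * γ i.succ = if i = j then (-2 : ℂ) • 1 else 0 := by
  rw [hγ.anticomm, metric]
  split_ifs with h
  · subst h
    rw [Matrix.diagonal_apply_eq]
    fin_cases i <;> simp
  · rw [Matrix.diagonal_apply_ne _ (by simpa using h)]
    simp

theorem IsDiracMatrices.conjTranspose_zero_mul (hγ : IsDiracMatrices γ) (μ : Fin 4) :
    (γ 0 * γ μ)ᴴ = γ 0 * γ μ := by
  rw [Matrix.conjTranspose_mul, hγ.herm_zero]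
  refine Fin.cases ?_ (fun i => ?_) μ
  · rw [hγ.herm_zero]
  · rw [hγ.herm_succ, neg_mul, hγ.succ_mul_zero, neg_neg]

theorem IsDiracMatrices.slash_mul_zero (hγ : IsDiracMatrices γ) (k : Fin 3 → ℝ) :
    slash γ k * γ 0 = -(γ 0 * slash γ k) := by
  simp only [slash, Finset.sum_mul, Finset.mul_sum, smul_mul_assoc, mul_smul_comm,
    hγ.succ_mul_zero, smul_neg, Finset.sum_neg_distrib]

theorem IsDiracMatrices.slash_mul_slash (hγ : IsDiracMatrices γ) (k : Fin 3 → ℝ) :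
    slash γ k * slash γ k = (-((∑ i, k i ^ 2 : ℝ) : ℂ)) • 1 := by
  have h1 : slash γ k * slash γ k = ∑ i, ∑ j, ((k i : ℂ) * k j) • (γ i.succ * γ j.succ) := by
    rw [slash, Finset.sum_mul_sum]
    simp only [smul_mul_smul_comm]
  have h2 : slash γ k * slash γ k = ∑ i, ∑ j, ((k i : ℂ) * k j) • (γ j.succ * γ i.succ) := by
    rw [h1, Finset.sum_comm]
    simp only [mul_comm]
  -- Symmetrizing the double sum brings in the anticommutators, of which only the diagonal ones
  -- survive.
  have h3 : (2 : ℂ) • (slash γ k * slash γ k) = (2 : ℂ) • ((-((∑ i, k i ^ 2 : ℝ) : ℂ)) • 1) := by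
    rw [two_smul]
    nth_rewrite 1 [h1]
    rw [h2]
    simp only [← Finset.sum_add_distrib, ← smul_add, hγ.succ_anticomm]
    simp only [smul_ite, smul_zero, Finset.sum_ite_eq, Finset.mem_univ, if_true, smul_smul,
      ← Finset.sum_smul]
    congr 1
    push_cast
    rw [← Finset.sum_mul]
    simp only [pow_two]
    ring
  exact smul_right_injective _ (two_ne_zero (α := ℂ)) h3

/-- The real bilinear form `(u, v) ↦ ū M v`. -/
def pairing (M : Matrix (Fin 4) (Fin 4) ℂ) : Spinor →L[ℝ] Spinor →L[ℝ] ℂ :=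
  LinearMap.toContinuousBilinearMap (LinearMap.mk₂ ℝ (fun u v : Spinor => star u ⬝ᵥ (M *ᵥ v))
    (fun u u' v => by simp [add_dotProduct])
    (fun c u v => by simp [smul_dotProduct])
    (fun u v v' => by simp [Matrix.mulVec_add])
    (fun c u v => by simp [Matrix.mulVec_smul]))

theorem pairing_apply (M : Matrix (Fin 4) (Fin 4) ℂ) (u v : Spinor) :
    pairing M u v = star u ⬝ᵥ (M *ᵥ v) := rfl

theorem star_mulVec_dotProduct {M : Matrix (Fin 4) (Fin 4) ℂ} (hM : Mᴴ = M) (u v : Spinor) :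
    star (M *ᵥ u) ⬝ᵥ v = star u ⬝ᵥ (M *ᵥ v) := by
  rw [Matrix.star_mulVec, hM, Matrix.dotProduct_mulVec]

theorem re_star_dotProduct_self_nonneg (u : Spinor) : 0 ≤ (star u ⬝ᵥ u).re := by
  simp only [dotProduct, Pi.star_apply, Complex.re_sum]
  refine Finset.sum_nonneg fun i _ => ?_
  have : (star (u i) * u i).re = (u i).re * (u i).re + (u i).im * (u i).im := by
    simp
  rw [this]
  exact add_nonneg (mul_self_nonneg _) (mul_self_nonneg _)

theorem eq_zero_of_re_star_dotProduct_self {u : Spinor} (h : (star u ⬝ᵥ u).re = 0) : u = 0 := by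
  simp only [dotProduct, Pi.star_apply, Complex.re_sum] at h
  have h1 : ∀ i, (star (u i) * u i).re = (u i).re * (u i).re + (u i).im * (u i).im := by
    intro i
    simp
  simp only [h1] at h
  rw [Finset.sum_eq_zero_iff_of_nonneg (fun i _ => add_nonneg (mul_self_nonneg _) (mul_self_nonneg _))] at h
  ext i
  have := h i (Finset.mem_univ i)
  exact Complex.ext (by simp; nlinarith [this, sq_nonneg (u i).re, sq_nonneg (u i).im])
    (by simp; nlinarith [this, sq_nonneg (u i).re, sq_nonneg (u i).im])

/-- The current is causal: `j^0 + n_i j^i ≥ 0` for `|n| ≤ 1`. -/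
theorem IsDiracMatrices.current_causal (hγ : IsDiracMatrices γ) (u : Spinor) (n : Fin 3 → ℝ)
    (hn : ∑ i, n i ^ 2 ≤ 1) :
    0 ≤ (star u ⬝ᵥ u + ∑ i : Fin 3, (n i : ℂ) * (star u ⬝ᵥ ((γ 0 * γ i.succ) *ᵥ u))).re := by
  have hA : ∑ i : Fin 3, (n i : ℂ) * (star u ⬝ᵥ ((γ 0 * γ i.succ) *ᵥ u)) =
      star u ⬝ᵥ ((γ 0 * slash γ n) *ᵥ u) := by
    simp only [slash, Finset.mul_sum, mul_smul_comm, Matrix.sum_mulVec, dotProduct_sum,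
      Matrix.smul_mulVec, dotProduct_smul, smul_eq_mul]
  have hherm : (γ 0 * slash γ n)ᴴ = γ 0 * slash γ n := by
    simp only [slash, Finset.mul_sum, mul_smul_comm, Matrix.conjTranspose_sum,
      Matrix.conjTranspose_smul, hγ.conjTranspose_zero_mul, Complex.star_def, Complex.conj_ofReal]
  have hsq : (γ 0 * slash γ n) * (γ 0 * slash γ n) = ((∑ i, n i ^ 2 : ℝ) : ℂ) • 1 := by
    calc (γ 0 * slash γ n) * (γ 0 * slash γ n) = γ 0 * (slash γ n * γ 0) * slash γ n := by
          noncomm_ring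
      _ = -((γ 0 * γ 0) * (slash γ n * slash γ n)) := by
          rw [hγ.slash_mul_zero]; noncomm_ring
      _ = _ := by rw [hγ.zero_mul_zero, hγ.slash_mul_slash]; simp
  rw [hA]
  set A := γ 0 * slash γ n
  -- `A` is hermitian with A² = |n|² ≤ 1, so 0 ≤ |u + Au|² ≤ 2(|u|² + ū·Au).
  have h0 := re_star_dotProduct_self_nonneg (u + A *ᵥ u)
  have h1 : star (u + A *ᵥ u) ⬝ᵥ (u + A *ᵥ u) =
      star u ⬝ᵥ u + 2 * (star u ⬝ᵥ (A *ᵥ u)) + ((∑ i, n i ^ 2 : ℝ) : ℂ) * (star u ⬝ᵥ u) := by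
    rw [star_add, add_dotProduct, star_mulVec_dotProduct hherm, Matrix.mulVec_add,
      Matrix.mulVec_mulVec, hsq, Matrix.smul_mulVec, Matrix.one_mulVec]
    simp only [dotProduct_add, dotProduct_smul, smul_eq_mul]
    ring
  rw [h1] at h0
  simp only [Complex.add_re, Complex.mul_re, Complex.ofReal_re, Complex.ofReal_im, Complex.re_ofNat,
    Complex.im_ofNat, zero_mul, sub_zero] at h0 ⊢
  have h2 := re_star_dotProduct_self_nonneg u
  nlinarith

theorem contDiff_current {n : WithTop ℕ∞} {ζ₁ ζ₂ : Spacetime → Spinor} (h₁ : ContDiff ℝ n ζ₁)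
    (h₂ : ContDiff ℝ n ζ₂) (μ : Fin 4) : ContDiff ℝ n (current γ ζ₁ ζ₂ μ) :=
  (pairing (γ 0 * γ μ)).isBoundedBilinearMap.contDiff.comp (h₁.prodMk h₂)

theorem fderiv_current {ζ₁ ζ₂ : Spacetime → Spinor} (h₁ : Differentiable ℝ ζ₁)
    (h₂ : Differentiable ℝ ζ₂) (μ : Fin 4) (p v : Spacetime) :
    fderiv ℝ (current γ ζ₁ ζ₂ μ) p v =
      star (fderiv ℝ ζ₁ p v) ⬝ᵥ ((γ 0 * γ μ) *ᵥ ζ₂ p) +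
      star (ζ₁ p) ⬝ᵥ ((γ 0 * γ μ) *ᵥ fderiv ℝ ζ₂ p v) := by
  have h := (pairing (γ 0 * γ μ)).hasFDerivAt_of_bilinear (h₁ p).hasFDerivAt (h₂ p).hasFDerivAt
  have h' : HasFDerivAt (current γ ζ₁ ζ₂ μ) _ p := h
  rw [h'.fderiv]
  simp only [_root_.add_apply, ContinuousLinearMap.precompR_apply,
    ContinuousLinearMap.precompL_apply, pairing_apply]
  exact add_comm _ _

theorem sum_mulVec_partialDeriv {m : ℝ} {ζ : Spacetime → Spinor} {p : Spacetime}
    (h : diracOp γ m ζ p = 0) :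
    ∑ μ, γ μ *ᵥ partialDeriv μ ζ p = (-(Complex.I * m)) • ζ p := by
  have h1 := congrArg (fun w => Complex.I • w) h
  simp only [diracOp, smul_add, smul_smul, smul_zero, mul_neg, Complex.I_mul_I, neg_neg,
    one_smul] at h1
  rw [neg_smul]
  exact eq_neg_of_add_eq_zero_left h1

/-- The current of two solutions is conserved. -/
theorem IsDiracMatrices.sum_partialDeriv_current (hγ : IsDiracMatrices γ) {m : ℝ}
    {ζ₁ ζ₂ : Spacetime → Spinor} (h₁ : Differentiable ℝ ζ₁) (h₂ : Differentiable ℝ ζ₂)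
    {p : Spacetime} (e₁ : diracOp γ m ζ₁ p = 0) (e₂ : diracOp γ m ζ₂ p = 0) :
    ∑ μ, partialDeriv μ (current γ ζ₁ ζ₂ μ) p = 0 := by
  have key : ∀ μ, partialDeriv μ (current γ ζ₁ ζ₂ μ) p =
      star (γ 0 *ᵥ (γ μ *ᵥ partialDeriv μ ζ₁ p)) ⬝ᵥ ζ₂ p +
      star (ζ₁ p) ⬝ᵥ (γ 0 *ᵥ (γ μ *ᵥ partialDeriv μ ζ₂ p)) := by
    intro μ
    rw [partialDeriv, fderiv_current h₁ h₂, ← star_mulVec_dotProduct (hγ.conjTranspose_zero_mul μ)]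
    simp only [Matrix.mulVec_mulVec, partialDeriv]
  simp only [key, Finset.sum_add_distrib, ← dotProduct_sum, ← sum_dotProduct, ← star_sum,
    ← Matrix.mulVec_sum]
  -- Only the mass terms remain. They carry the factors −im and its conjugate im, and cancel.
  rw [sum_mulVec_partialDeriv e₁, sum_mulVec_partialDeriv e₂, star_mulVec_dotProduct hγ.herm_zero,
    Matrix.mulVec_smul, star_smul, smul_dotProduct, dotProduct_smul, ← add_smul]
  simp

theorem sum_partialDeriv_eq {E : Type*} [NormedAddCommGroup E] [NormedSpace ℝ E]
    (j : Fin 4 → Spacetime → E) (p : Spacetime) :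
    ∑ μ, partialDeriv μ (j μ) p = fderiv ℝ (j 0) p (1, 0) +
      ∑ i : Fin 3, fderiv ℝ (j i.succ) p (0, EuclideanSpace.single i 1) := by
  rw [Fin.sum_univ_succ]
  rfl

end

/-! ### Finite propagation speed -/

section

variable {γ : Fin 4 → Matrix (Fin 4) (Fin 4) ℂ} {m : ℝ}

theorem fderiv_slice {E : Type*} [NormedAddCommGroup E] [NormedSpace ℝ E] {F : Spacetime → E}
    (hF : Differentiable ℝ F) (t : ℝ) (y v : Space) :
    fderiv ℝ (fun z => F (t, z)) y v = fderiv ℝ F (t, y) (0, v) := by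
  have h := (hF (t, y)).hasFDerivAt.comp y ((hasFDerivAt_const t y).prodMk (hasFDerivAt_id y))
  have h' : HasFDerivAt (fun z => F (t, z)) _ y := h
  rw [h'.fderiv]
  rfl

/-- Current conservation gives ∂_μ(χj^μ) = (∂_μχ)j^μ, and the spatial divergences integrate to zero.
The support is controlled only near `t₀`, since that of a cone weight varies with time. -/
theorem IsDiracMatrices.hasDerivAt_integral_weight (hγ : IsDiracMatrices γ)
    {ζ₁ ζ₂ : Spacetime → Spinor} (h₁ : ContDiff ℝ 1 ζ₁) (h₂ : ContDiff ℝ 1 ζ₂)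
    (e₁ : ∀ p, diracOp γ m ζ₁ p = 0) (e₂ : ∀ p, diracOp γ m ζ₂ p = 0)
    {χ : Spacetime → ℝ} (hχ : ContDiff ℝ 1 χ) {t₀ R : ℝ}
    (hs : ∀ t ∈ Metric.ball t₀ 1, ∀ y, R < ‖y‖ → χ (t, y) = 0) :
    HasDerivAt (fun t => ∫ y, (χ (t, y) : ℂ) * current γ ζ₁ ζ₂ 0 (t, y))
      (∫ y, ∑ μ, ((partialDeriv μ χ (t₀, y) : ℝ) : ℂ) * current γ ζ₁ ζ₂ μ (t₀, y)) t₀ := by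
  set F : Fin 4 → Spacetime → ℂ := fun μ p => (χ p : ℂ) * current γ ζ₁ ζ₂ μ p with hFdef
  have hχc : ContDiff ℝ 1 fun p => (χ p : ℂ) := Complex.ofRealCLM.contDiff.comp hχ
  have hF : ∀ μ, ContDiff ℝ 1 (F μ) := fun μ => hχc.mul (contDiff_current h₁ h₂ μ)
  have h1d := h₁.differentiable one_ne_zero
  have h2d := h₂.differentiable one_ne_zero
  have hsF : ∀ μ, ∀ t ∈ Metric.ball t₀ 1, ∀ y, R < ‖y‖ → F μ (t, y) = 0 := by
    intro μ t ht y hy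
    simp [hFdef, hs t ht y hy]
  have hsum : ∀ p, ∑ μ, partialDeriv μ (F μ) p =
      ∑ μ, ((partialDeriv μ χ p : ℝ) : ℂ) * current γ ζ₁ ζ₂ μ p := by
    intro p
    have : ∀ μ, partialDeriv μ (F μ) p = (χ p : ℂ) * partialDeriv μ (current γ ζ₁ ζ₂ μ) p +
        ((partialDeriv μ χ p : ℝ) : ℂ) * current γ ζ₁ ζ₂ μ p := by
      intro μ
      have hc : HasFDerivAt (fun p => (χ p : ℂ)) (Complex.ofRealCLM.comp (fderiv ℝ χ p)) p :=
        Complex.ofRealCLM.hasFDerivAt.comp p (hχ.differentiable one_ne_zero p).hasFDerivAt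
      have hj := ((contDiff_current (γ := γ) h₁ h₂ μ).differentiable one_ne_zero p).hasFDerivAt
      have hFμ : HasFDerivAt (F μ) _ p := hc.mul hj
      rw [partialDeriv, hFμ.fderiv]
      simp only [partialDeriv, _root_.add_apply, _root_.smul_apply, smul_eq_mul,
        ContinuousLinearMap.comp_apply, Complex.ofRealCLM_apply]
      ring
    simp only [this, Finset.sum_add_distrib, ← Finset.mul_sum]
    rw [hγ.sum_partialDeriv_current h1d h2d (e₁ p) (e₂ p), mul_zero, zero_add]
  have hderiv := hasDerivAt_integral_slice (hF 0) (hsF 0)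
  suffices hval : (∫ y, ∑ μ, ((partialDeriv μ χ (t₀, y) : ℝ) : ℂ) * current γ ζ₁ ζ₂ μ (t₀, y)) =
      ∫ y, fderiv ℝ (F 0) (t₀, y) (1, 0) by
    rw [hval]; exact hderiv
  have hball : t₀ ∈ Metric.ball t₀ 1 := Metric.mem_ball_self one_pos
  have hslice : ∀ i : Fin 3, ContDiff ℝ 1 fun y : Space => F i.succ (t₀, y) := fun i =>
    (hF i.succ).comp (contDiff_const.prodMk contDiff_id)
  have hcomp : ∀ i : Fin 3, HasCompactSupport fun y : Space => F i.succ (t₀, y) := fun i =>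
    hasCompactSupport_of_eq_zero_of_lt (hsF i.succ t₀ hball)
  have hzero : ∀ i : Fin 3,
      ∫ y, fderiv ℝ (F i.succ) (t₀, y) (0, EuclideanSpace.single i 1) = 0 := by
    intro i
    rw [← integral_spacePartial_eq_zero (hslice i) (hcomp i) i]
    simp only [spacePartial, fderiv_slice ((hF i.succ).differentiable one_ne_zero)]
  have hint : ∀ i : Fin 3,
      Integrable fun y => fderiv ℝ (F i.succ) (t₀, y) (0, EuclideanSpace.single i 1) := by
    intro i
    have hd := (hslice i).continuous_fderiv_apply one_ne_zero
    have hd' : Continuous fun y => fderiv ℝ (fun z => F i.succ (t₀, z)) y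
      (EuclideanSpace.single i 1) := hd.comp (by fun_prop : Continuous fun y : Space =>
        (y, (EuclideanSpace.single i 1 : Space)))
    have := hd'.integrable_of_hasCompactSupport (μ := volume) ((hcomp i).fderiv_apply ℝ _)
    simpa only [fderiv_slice ((hF i.succ).differentiable one_ne_zero)] using this
  have hint0 : Integrable fun y => fderiv ℝ (F 0) (t₀, y) (1, 0) := by
    have hd := (hF 0).continuous_fderiv_apply one_ne_zero
    have hd' : Continuous fun y : Space => fderiv ℝ (F 0) (t₀, y) (1, 0) :=
      hd.comp (by fun_prop : Continuous fun y : Space => ((t₀, y), ((1, 0) : Spacetime)))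
    refine integrable_of_eq_zero_of_lt (R := R) hd' fun y hy => ?_
    have h1 : HasDerivAt (fun s => F 0 (s, y)) 0 t₀ :=
      (hasDerivAt_const t₀ (0 : ℂ)).congr_of_eventuallyEq
        (Filter.eventually_of_mem (Metric.isOpen_ball.mem_nhds hball) fun s hs => hsF 0 s hs y hy)
    exact (hasDerivAt_slice (hF 0) t₀ y).unique h1
  rw [integral_congr_ae (Eventually.of_forall fun y => (hsum (t₀, y)).symm)]
  simp only [sum_partialDeriv_eq]
  rw [integral_add hint0 (integrable_finsetSum _ fun i _ => hint i),
    integral_finsetSum _ fun i _ => hint i]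
  simp [hzero]

/-- A smooth function on the region below the backward cone with vertex `(T, x)`, decreasing along
causal directions. -/
def coneWeight (x : Space) (T ε : ℝ) (p : Spacetime) : ℝ :=
  expNegInvGlue (T - p.1 - Real.sqrt (‖p.2 - x‖ ^ 2 + ε ^ 2))

theorem contDiff_coneWeight (x : Space) (T : ℝ) {ε : ℝ} (hε : 0 < ε) :
    ContDiff ℝ 1 (coneWeight x T ε) := by
  refine (expNegInvGlue.contDiff (n := 1)).comp ((contDiff_const.sub contDiff_fst).sub ?_)
  refine ContDiff.sqrt (((contDiff_snd.sub contDiff_const).norm_sq ℝ).add contDiff_const) ?_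
  intro p
  positivity

/-- The gradient is −a(1, n) with n = (y − x)/√(|y − x|² + ε²), which is the form that
`IsDiracMatrices.current_causal` requires. The term ε² smooths the norm at y = x and keeps |n| below
1. -/
theorem partialDeriv_coneWeight (x : Space) (T : ℝ) {ε : ℝ} (hε : 0 < ε) (p : Spacetime) :
    ∃ (a : ℝ) (n : Fin 3 → ℝ), 0 ≤ a ∧ ∑ i, n i ^ 2 ≤ 1 ∧
      partialDeriv 0 (coneWeight x T ε) p = -a ∧
      ∀ i : Fin 3, partialDeriv i.succ (coneWeight x T ε) p = -(a * n i) := by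
  set q : ℝ := ‖p.2 - x‖ ^ 2 + ε ^ 2 with hq
  have hqpos : 0 < q := by positivity
  set w : ℝ := T - p.1 - Real.sqrt q with hw
  have hη : HasDerivAt expNegInvGlue (deriv expNegInvGlue w) w :=
    ((expNegInvGlue.contDiff (n := 1)).differentiable one_ne_zero w).hasDerivAt
  have h1 : HasFDerivAt (fun p : Spacetime => p.2 - x) (ContinuousLinearMap.snd ℝ ℝ Space) p :=
    hasFDerivAt_snd.sub_const x
  have h2 := ((h1.norm_sq.add_const (ε ^ 2)).sqrt hqpos.ne')
  have h3 : HasFDerivAt (fun p : Spacetime => T - p.1) (-(ContinuousLinearMap.fst ℝ ℝ Space)) p :=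
    hasFDerivAt_fst.const_sub T
  have h4 := hη.comp_hasFDerivAt p (h3.sub h2)
  have h5 : HasFDerivAt (coneWeight x T ε) _ p := h4
  refine ⟨deriv expNegInvGlue w, fun i => (p.2 - x) i / Real.sqrt q,
    expNegInvGlue.monotone.deriv_nonneg, ?_, ?_, fun i => ?_⟩
  · simp only [div_pow, Real.sq_sqrt hqpos.le, ← Finset.sum_div]
    rw [div_le_one hqpos, hq, EuclideanSpace.norm_sq_eq]
    simp only [Real.norm_eq_abs, sq_abs]
    nlinarith [sq_nonneg ε]
  · rw [partialDeriv, h5.fderiv]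
    simp [basisVec]
  · rw [partialDeriv, h5.fderiv]
    have : (basisVec i.succ : Spacetime) = (0, EuclideanSpace.single i 1) := rfl
    rw [this]
    simp only [_root_.smul_apply, _root_.sub_apply, _root_.neg_apply,
      ContinuousLinearMap.comp_apply, ContinuousLinearMap.coe_fst', ContinuousLinearMap.coe_snd',
      innerSL_apply_apply, smul_eq_mul, ← hq, EuclideanSpace.inner_single_right]
    have := (Real.sqrt_pos.2 hqpos).ne'
    simp
    field_simp
    exact Or.inl trivial

/-- Energy method: the weighted charge `E` is nonincreasing. It vanishes at time 0, where either the
weight or ζ is zero. At time t it is the integral of a nonnegative continuous function, which must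
then vanish identically, in particular at x, where the weight is positive. -/
theorem IsDiracMatrices.eq_zero_of_forward_cone (hγ : IsDiracMatrices γ) {ζ : Spacetime → Spinor}
    (hζ : ContDiff ℝ 1 ζ) (e : ∀ p, diracOp γ m ζ p = 0) {x : Space} {T t : ℝ}
    (h0 : ∀ y, dist y x < T → ζ (0, y) = 0) (ht : 0 ≤ t) (htT : t < T) : ζ (t, x) = 0 := by
  -- Any ε in (0, T − t) would do: the weight at (t, x) is positive exactly when T − t − ε > 0.
  set ε : ℝ := (T - t) / 2
  have hε : 0 < ε := by simp only [ε]; linarith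
  set χ := coneWeight x T ε with hχdef
  have hχ : ContDiff ℝ 1 χ := contDiff_coneWeight x T hε
  have hχ0 : ∀ s y, T - s ≤ ‖y - x‖ → χ (s, y) = 0 := by
    intro s y h
    refine expNegInvGlue.zero_of_nonpos ?_
    have : ‖y - x‖ ≤ Real.sqrt (‖y - x‖ ^ 2 + ε ^ 2) :=
      Real.le_sqrt_of_sq_le (by nlinarith [sq_nonneg ε])
    simp only
    linarith
  have hsupp : ∀ t₀, ∀ s ∈ Metric.ball t₀ 1, ∀ y : Space, |T - t₀| + 1 + ‖x‖ < ‖y‖ →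
      χ (s, y) = 0 := by
    intro t₀ s hs y hy
    apply hχ0
    rw [Metric.mem_ball, Real.dist_eq, abs_lt] at hs
    have h1 := norm_sub_norm_le y x
    have h2 := le_abs_self (T - t₀)
    linarith
  set E : ℝ → ℝ := fun s => (∫ y, (χ (s, y) : ℂ) * current γ ζ ζ 0 (s, y)).re with hE
  have hderiv : ∀ s, HasDerivAt E
      (∫ y, ∑ μ, ((partialDeriv μ χ (s, y) : ℝ) : ℂ) * current γ ζ ζ μ (s, y)).re s := fun s =>
    Complex.reCLM.hasFDerivAt.comp_hasDerivAt s
      (hγ.hasDerivAt_integral_weight hζ hζ e e hχ (hsupp s))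
  have hanti : Antitone E := by
    refine antitone_of_deriv_nonpos (fun s => (hderiv s).differentiableAt) fun s => ?_
    rw [(hderiv s).deriv]
    by_cases hi : Integrable fun y =>
        ∑ μ, ((partialDeriv μ χ (s, y) : ℝ) : ℂ) * current γ ζ ζ μ (s, y)
    swap
    -- The integral of a non-integrable function is 0 by convention, which also satisfies the
    -- inequality.
    · rw [integral_undef hi]; simp
    have hre := Complex.reCLM.integral_comp_comm hi
    simp only [Complex.reCLM_apply] at hre
    rw [← hre]
    refine integral_nonpos fun y => ?_
    obtain ⟨a, n, ha, hn, hd0, hdi⟩ := partialDeriv_coneWeight x T hε (s, y)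
    have hc := hγ.current_causal (ζ (s, y)) n hn
    have hsum : ∑ μ, ((partialDeriv μ χ (s, y) : ℝ) : ℂ) * current γ ζ ζ μ (s, y) =
        ((-a : ℝ) : ℂ) * (star (ζ (s, y)) ⬝ᵥ ζ (s, y) + ∑ i : Fin 3,
          (n i : ℂ) * (star (ζ (s, y)) ⬝ᵥ ((γ 0 * γ i.succ) *ᵥ ζ (s, y)))) := by
      rw [Fin.sum_univ_succ, hd0]
      simp only [hχdef, hdi, current, hγ.zero_mul_zero, Matrix.one_mulVec, mul_add,
        Finset.mul_sum]
      congr 1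
      refine Finset.sum_congr rfl fun i _ => ?_
      push_cast
      ring
    simp only [Pi.zero_apply]
    rw [hsum, Complex.re_ofReal_mul]
    nlinarith
  have hE0 : E 0 = 0 := by
    have : ∀ y, (χ (0, y) : ℂ) * current γ ζ ζ 0 (0, y) = 0 := by
      intro y
      by_cases hy : dist y x < T
      · simp [current, h0 y hy]
      · rw [hχ0 0 y (by rw [← dist_eq_norm]; linarith)]
        simp
    simp [hE, this]
  have hEt : E t ≤ 0 := hE0 ▸ hanti ht
  set f : Space → ℝ := fun y => ((χ (t, y) : ℂ) * current γ ζ ζ 0 (t, y)).re with hf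
  have hfc : Continuous f := by
    have h1 : Continuous χ := hχ.continuous
    have h2 : Continuous (current γ ζ ζ 0) := (contDiff_current hζ hζ 0).continuous
    fun_prop
  have hzero : ∀ y : Space, |T - t| + 1 + ‖x‖ < ‖y‖ →
      (χ (t, y) : ℂ) * current γ ζ ζ 0 (t, y) = 0 := fun y hy => by
    simp [hsupp t t (Metric.mem_ball_self one_pos) y hy]
  have hfi : Integrable f := integrable_of_eq_zero_of_lt (R := |T - t| + 1 + ‖x‖) hfc
    fun y hy => by simp only [hf]; rw [hzero y hy]; simp
  have hfpos : 0 ≤ f := by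
    intro y
    simp only [hf, Complex.re_ofReal_mul, current, hγ.zero_mul_zero, Matrix.one_mulVec,
      Pi.zero_apply]
    exact mul_nonneg (expNegInvGlue.nonneg _) (re_star_dotProduct_self_nonneg _)
  have hEf : E t = ∫ y, f y := by
    have h1 : Continuous χ := hχ.continuous
    have h2 : Continuous (current γ ζ ζ 0) := (contDiff_current hζ hζ 0).continuous
    have hi : Integrable fun y => (χ (t, y) : ℂ) * current γ ζ ζ 0 (t, y) :=
      integrable_of_eq_zero_of_lt (by fun_prop) hzero
    exact (Complex.reCLM.integral_comp_comm hi).symm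
  have hint : ∫ y, f y = 0 := le_antisymm (hEf ▸ hEt) (integral_nonneg hfpos)
  rw [integral_eq_zero_iff_of_nonneg hfpos hfi] at hint
  have hfz : f = 0 := (Continuous.ae_eq_iff_eq volume hfc continuous_const).1 hint
  have hx : f x = 0 := congrFun hfz x
  simp only [hf, Complex.re_ofReal_mul, current, hγ.zero_mul_zero, Matrix.one_mulVec] at hx
  have hχx : 0 < χ (t, x) := by
    refine expNegInvGlue.pos_of_pos ?_
    simp only [sub_self, norm_zero]
    rw [zero_pow two_ne_zero, zero_add, Real.sqrt_sq hε.le]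
    simp only [ε]
    linarith
  exact eq_zero_of_re_star_dotProduct_self ((mul_eq_zero.1 hx).resolve_left hχx.ne')

end

/-! ### Time reversal, domains of dependence and uniqueness -/

section

variable {γ : Fin 4 → Matrix (Fin 4) (Fin 4) ℂ} {m : ℝ}

theorem diracOp_eq (ζ : Spacetime → Spinor) (p : Spacetime) :
    diracOp γ m ζ p = (-Complex.I) • (γ 0 *ᵥ fderiv ℝ ζ p (1, 0) +
      ∑ i : Fin 3, γ i.succ *ᵥ fderiv ℝ ζ p (0, EuclideanSpace.single i 1)) + (m : ℂ) • ζ p := by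
  rw [diracOp, Fin.sum_univ_succ]
  rfl

/-- The Clifford relations do not see the sign of γ⁰, and t ↦ −t exchanges the Dirac equations of
the two families. The backward cone thus reduces to the forward one. -/
theorem IsDiracMatrices.timeReversal (hγ : IsDiracMatrices γ) :
    IsDiracMatrices (Fin.cons (-γ 0) fun i => γ i.succ) where
  anticomm μ ν := by
    have h := hγ.anticomm μ ν
    revert h
    refine Fin.cases ?_ (fun i => ?_) μ <;> refine Fin.cases ?_ (fun j => ?_) ν <;> intro h
    · simpa using h
    · rw [metric, Matrix.diagonal_apply_ne _ (Fin.succ_ne_zero j).symm] at h ⊢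
      simp only [Fin.cons_zero, Fin.cons_succ, neg_mul, mul_neg, mul_zero, zero_smul,
        ← neg_add, neg_eq_zero] at h ⊢
      exact h
    · rw [metric, Matrix.diagonal_apply_ne _ (Fin.succ_ne_zero i)] at h ⊢
      simp only [Fin.cons_zero, Fin.cons_succ, neg_mul, mul_neg, mul_zero, zero_smul,
        ← neg_add, neg_eq_zero] at h ⊢
      exact h
    · simpa using h
  herm_zero := by simp [hγ.herm_zero]
  herm_succ i := by simp [hγ.herm_succ]

theorem diracOp_timeReversal {ζ : Spacetime → Spinor} (hζ : Differentiable ℝ ζ) (p : Spacetime) :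
    diracOp (Fin.cons (-γ 0) fun i => γ i.succ) m (fun p => ζ (-p.1, p.2)) p =
      diracOp γ m ζ (-p.1, p.2) := by
  have h := (hζ (-p.1, p.2)).hasFDerivAt.comp p
    ((hasFDerivAt_fst (𝕜 := ℝ) (p := p)).neg.prodMk (hasFDerivAt_snd (𝕜 := ℝ) (p := p)))
  have h' : HasFDerivAt (fun p : Spacetime => ζ (-p.1, p.2)) _ p := h
  rw [diracOp_eq, diracOp_eq, h'.fderiv]
  have : ((-1, 0) : Spacetime) = -(1, 0) := by simp
  simp [this, Matrix.neg_mulVec, Matrix.mulVec_neg, -Prod.neg_mk]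

theorem diracOp_translate (ζ : Spacetime → Spinor) (a p : Spacetime) :
    diracOp γ m (fun p => ζ (p + a)) p = diracOp γ m ζ (p + a) := by
  rw [diracOp_eq, diracOp_eq, fderiv_comp_add_right]

theorem IsDiracMatrices.eq_zero_of_cone (hγ : IsDiracMatrices γ) {ζ : Spacetime → Spinor}
    (hζ : ContDiff ℝ 1 ζ) (e : ∀ p, diracOp γ m ζ p = 0) {s : ℝ} {x : Space} {T t : ℝ}
    (h0 : ∀ y, dist y x < T → ζ (s, y) = 0) (ht : |t - s| < T) : ζ (t, x) = 0 := by
  set ζ' : Spacetime → Spinor := fun p => ζ (p + (s, 0)) with hζ'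
  have hζ'1 : ContDiff ℝ 1 ζ' := hζ.comp (contDiff_id.add contDiff_const)
  have e' : ∀ p, diracOp γ m ζ' p = 0 := fun p => by rw [hζ', diracOp_translate, e]
  have h0' : ∀ y, dist y x < T → ζ' (0, y) = 0 := fun y hy => by simp [hζ', h0 y hy]
  have main : ζ' (t - s, x) = 0 := by
    rcases le_total 0 (t - s) with h | h
    · exact hγ.eq_zero_of_forward_cone hζ'1 e' h0' h (by rwa [abs_of_nonneg h] at ht)
    · have h1 : ContDiff ℝ 1 fun p : Spacetime => ζ' (-p.1, p.2) :=
        hζ'1.comp (contDiff_fst.neg.prodMk contDiff_snd)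
      have := hγ.timeReversal.eq_zero_of_forward_cone (m := m) h1
        (fun p => by rw [diracOp_timeReversal (hζ'1.differentiable one_ne_zero), e'])
        (x := x) (T := T) (t := -(t - s)) (fun y hy => by simpa using h0' y hy) (by linarith)
        (by rwa [abs_of_nonpos h] at ht)
      simpa using this
  simpa [hζ'] using main

theorem isClosed_lightCone : IsClosed lightCone := by
  refine isClosed_le ?_ continuous_const
  unfold minkowskiSq
  fun_prop

theorem mem_lightCone_iff (p : Spacetime) : p ∈ lightCone ↔ ‖p.2‖ ≤ |p.1| := by
  have h : ‖p.2‖ ≤ |p.1| ↔ ‖p.2‖ ^ 2 ≤ p.1 ^ 2 := by rw [sq_le_sq, abs_norm]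
  simp only [lightCone, minkowskiSq, Set.mem_ofPred_eq]
  rw [h]
  constructor <;> intro h <;> linarith

theorem mem_causalShadow_iff (O : Set Spacetime) (p : Spacetime) :
    p ∈ causalShadow O ↔ ∃ q ∈ O, ‖p.2 - q.2‖ ≤ |p.1 - q.1| := by
  simp only [causalShadow, Set.mem_add]
  constructor
  · rintro ⟨q, hq, r, hr, rfl⟩
    refine ⟨q, hq, ?_⟩
    simpa [mem_lightCone_iff] using hr
  · rintro ⟨q, hq, h⟩
    exact ⟨q, hq, p - q, by simpa [mem_lightCone_iff] using h, by simp⟩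

theorem isClosed_causalShadow {K : Set Spacetime} (hK : IsCompact K) :
    IsClosed (causalShadow K) :=
  isClosed_lightCone.add_left_of_isCompact hK

theorem causalShadow_mono {A B : Set Spacetime} (h : A ⊆ B) : causalShadow A ⊆ causalShadow B :=
  Set.add_subset_add_right h

/-- Finite propagation speed. -/
theorem IsDiracMatrices.mem_causalShadow_of_ne_zero (hγ : IsDiracMatrices γ)
    {ζ : Spacetime → Spinor} (hζ : ContDiff ℝ 1 ζ) (e : ∀ p, diracOp γ m ζ p = 0) {s : ℝ}
    {A : Set Space} (hA : IsCompact A) (h0 : ∀ y, y ∉ A → ζ (s, y) = 0) {p : Spacetime}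
    (hp : ζ p ≠ 0) : p ∈ causalShadow ({s} ×ˢ A) := by
  obtain ⟨t, x⟩ := p
  -- `Metric.infDist` to the empty set is 0, so this case is separate: the data vanish on balls of
  -- every radius.
  rcases A.eq_empty_or_nonempty with rfl | hne
  · exact absurd (hγ.eq_zero_of_cone hζ e (x := x) (fun y _ => h0 y (Set.notMem_empty y))
      (lt_add_one |t - s|)) hp
  obtain ⟨y, hyA, hy⟩ := hA.exists_infDist_eq_dist hne x
  rw [mem_causalShadow_iff]
  refine ⟨(s, y), ⟨rfl, hyA⟩, ?_⟩
  -- Otherwise the nearest point of `A` is farther from x than |t − s|, and the data vanish on an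
  -- open ball around x of that larger radius.
  by_contra! hlt
  refine hp (hγ.eq_zero_of_cone hζ e (s := s) (T := Metric.infDist x A) (fun z hz => h0 z
    fun hzA => ?_) ?_)
  · have := Metric.infDist_le_dist_of_mem (x := x) hzA
    rw [dist_comm] at this
    linarith
  · rw [hy, dist_eq_norm]
    exact hlt

theorem IsDiracMatrices.tsupport_subset (hγ : IsDiracMatrices γ)
    {ζ : Spacetime → Spinor} (hζ : ContDiff ℝ 1 ζ) (e : ∀ p, diracOp γ m ζ p = 0) {s : ℝ}
    {A : Set Space} (hA : IsCompact A) (h0 : ∀ y, y ∉ A → ζ (s, y) = 0) :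
    tsupport ζ ⊆ causalShadow ({s} ×ˢ A) :=
  closure_minimal (fun _ hp => hγ.mem_causalShadow_of_ne_zero hζ e hA h0 hp)
    (isClosed_causalShadow (isCompact_singleton.prod hA))

theorem diracOp_sub {ζ₁ ζ₂ : Spacetime → Spinor} (h₁ : Differentiable ℝ ζ₁)
    (h₂ : Differentiable ℝ ζ₂) (p : Spacetime) :
    diracOp γ m (fun p => ζ₁ p - ζ₂ p) p = diracOp γ m ζ₁ p - diracOp γ m ζ₂ p := by
  simp only [diracOp_eq, fderiv_fun_sub (h₁ p) (h₂ p), _root_.sub_apply, Matrix.mulVec_sub,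
    Finset.sum_sub_distrib, smul_sub, smul_add]
  abel

theorem diracOp_add {ζ₁ ζ₂ : Spacetime → Spinor} (h₁ : Differentiable ℝ ζ₁)
    (h₂ : Differentiable ℝ ζ₂) (p : Spacetime) :
    diracOp γ m (fun p => ζ₁ p + ζ₂ p) p = diracOp γ m ζ₁ p + diracOp γ m ζ₂ p := by
  simp only [diracOp_eq, fderiv_fun_add (h₁ p) (h₂ p), _root_.add_apply, Matrix.mulVec_add,
    Finset.sum_add_distrib, smul_add]
  abel

/-- A solution of the Dirac equation is determined by its values at one time. -/
theorem IsDiracMatrices.eq_of_eq_slice (hγ : IsDiracMatrices γ) {ζ₁ ζ₂ : Spacetime → Spinor}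
    (h₁ : ContDiff ℝ 1 ζ₁) (h₂ : ContDiff ℝ 1 ζ₂) (e₁ : ∀ p, diracOp γ m ζ₁ p = 0)
    (e₂ : ∀ p, diracOp γ m ζ₂ p = 0) {s : ℝ} (h0 : ∀ y, ζ₁ (s, y) = ζ₂ (s, y)) : ζ₁ = ζ₂ := by
  funext p
  have hsub : ∀ p, diracOp γ m (fun p => ζ₁ p - ζ₂ p) p = 0 := fun p => by
    rw [diracOp_sub (h₁.differentiable one_ne_zero) (h₂.differentiable one_ne_zero), e₁, e₂,
      sub_zero]
  exact sub_eq_zero.1 (hγ.eq_zero_of_cone (h₁.sub h₂) hsub (s := s) (x := p.2) (t := p.1)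
    (fun y _ => sub_eq_zero.2 (h0 y)) (lt_add_one _))

end

/-! ### The spatial Fourier transform of test functions -/

/-- The spatial Fourier transform `∫ exp(-i k·y) f(s, y) dy` of `f` at time `s`. -/
def sliceFourier (f : Spacetime → Spinor) (q : Spacetime) : Spinor :=
  ∫ y : Space, Complex.exp (-(Complex.I * ((inner ℝ q.2 y : ℝ) : ℂ))) • f (q.1, y)

theorem norm_exp_neg_I_mul (r : ℝ) : ‖Complex.exp (-(Complex.I * (r : ℂ)))‖ = 1 := by
  have := norm_exp_I_mul (-r)
  push_cast at this
  rwa [mul_neg] at this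

section

variable {f : Spacetime → Spinor}

theorem measurable_sliceFourier (hf : Continuous f) : Measurable (sliceFourier f) := by
  have h : Continuous fun z : Spacetime × Space =>
      Complex.exp (-(Complex.I * ((inner ℝ z.1.2 z.2 : ℝ) : ℂ))) • f (z.1.1, z.2) := by
    fun_prop
  exact (h.stronglyMeasurable.integral_prod_right' (ν := volume)).measurable

theorem hasCompactSupport_slice (hc : HasCompactSupport f) (s : ℝ) :
    HasCompactSupport fun y => f (s, y) := by
  refine HasCompactSupport.intro (hc.isCompact.image continuous_snd) fun y hy => ?_
  by_contra h
  exact hy ⟨(s, y), subset_tsupport _ h, rfl⟩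

theorem exists_slice_radius (hc : HasCompactSupport f) :
    ∃ R : ℝ, 0 ≤ R ∧ (∀ s y, R < |s| → f (s, y) = 0) ∧ ∀ s y, R < ‖y‖ → f (s, y) = 0 := by
  obtain ⟨R, hR⟩ := hc.isCompact.isBounded.exists_norm_le
  have key : ∀ s y, f (s, y) ≠ 0 → |s| ≤ R ∧ ‖y‖ ≤ R := by
    intro s y h
    have := hR (s, y) (subset_tsupport _ h)
    rw [Prod.norm_def, max_le_iff] at this
    exact this
  refine ⟨max R 0, le_max_right _ _, fun s y h => ?_, fun s y h => ?_⟩ <;> by_contra hne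
  · exact absurd ((key s y hne).1.trans (le_max_left _ _)) (not_le.2 h)
  · exact absurd ((key s y hne).2.trans (le_max_left _ _)) (not_le.2 h)

theorem sliceFourier_eq_zero {s : ℝ} (h : ∀ y, f (s, y) = 0) (k : Space) :
    sliceFourier f (s, k) = 0 := by
  simp [sliceFourier, h]

theorem integral_exp_smul_spacePartial {φ : Space → Spinor} (hφ : ContDiff ℝ 1 φ)
    (hc : HasCompactSupport φ) (k : Space) (i : Fin 3) :
    ∫ y, Complex.exp (Complex.I * ((inner ℝ k y : ℝ) : ℂ)) • spacePartial i φ y =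
      (-(Complex.I * ((k i : ℝ) : ℂ))) •
        ∫ y, Complex.exp (Complex.I * ((inner ℝ k y : ℝ) : ℂ)) • φ y := by
  set e : Space → ℂ := fun y => Complex.exp (Complex.I * ((inner ℝ k y : ℝ) : ℂ)) with he
  have hd : ∀ y, HasFDerivAt e
      (e y • (Complex.I • (Complex.ofRealCLM.comp (innerSL ℝ k)))) y := by
    intro y
    have h1 : HasFDerivAt (fun y : Space => ((inner ℝ k y : ℝ) : ℂ))
        (Complex.ofRealCLM.comp (innerSL ℝ k)) y :=
      (Complex.ofRealCLM.comp (innerSL ℝ k)).hasFDerivAt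
    exact (h1.const_mul Complex.I).cexp
  have hev : ∀ y, fderiv ℝ e y (EuclideanSpace.single i 1) =
      Complex.I * ((k i : ℝ) : ℂ) * e y := by
    intro y
    rw [(hd y).fderiv]
    simp [EuclideanSpace.inner_single_right]
    ring
  have hec : Continuous e := by rw [he]; fun_prop
  have hφd : Continuous fun y => fderiv ℝ φ y (EuclideanSpace.single i 1) := by
    have := hφ.continuous_fderiv one_ne_zero
    fun_prop
  have hcs : HasCompactSupport fun y => fderiv ℝ φ y (EuclideanSpace.single i 1) :=
    hc.fderiv_apply ℝ _
  have i1 : Integrable fun y => e y • fderiv ℝ φ y (EuclideanSpace.single i 1) :=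
    (hec.smul hφd).integrable_of_hasCompactSupport hcs.smul_left
  have i2 : Integrable fun y => e y • φ y :=
    (hec.smul hφ.continuous).integrable_of_hasCompactSupport hc.smul_left
  have i3 : Integrable fun y => fderiv ℝ e y (EuclideanSpace.single i 1) • φ y := by
    simp only [hev, mul_smul]
    exact (i2.smul ((k i : ℝ) : ℂ)).smul Complex.I
  have := integral_smul_fderiv_eq_neg_fderiv_smul_of_integrable (μ := volume) i3 i1 i2
    (fun y _ => (hd y).differentiableAt) (fun y _ => hφ.differentiable one_ne_zero y)
  simp only [spacePartial]
  rw [this]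
  simp only [hev, mul_smul, neg_smul]
  rw [integral_smul, integral_smul]

theorem sliceFourier_partialDeriv (hf : ContDiff ℝ 1 f) (hc : HasCompactSupport f) (i : Fin 3)
    (q : Spacetime) :
    sliceFourier (partialDeriv i.succ f) q = (Complex.I * ((q.2 i : ℝ) : ℂ)) • sliceFourier f q := by
  have h := integral_exp_smul_spacePartial (φ := fun y => f (q.1, y))
    (hf.comp (contDiff_const.prodMk contDiff_id)) (hasCompactSupport_slice hc q.1) (-q.2) i
  simp only [spacePartial, fderiv_slice (hf.differentiable one_ne_zero), inner_neg_left,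
    Complex.ofReal_neg, mul_neg, PiLp.neg_apply, neg_neg] at h
  exact h

theorem contDiff_partialDeriv (hf : ContDiff ℝ ∞ f) (μ : Fin 4) :
    ContDiff ℝ ∞ (partialDeriv μ f) :=
  (contDiff_infty_iff_fderiv.1 hf).2.clm_apply contDiff_const

theorem hasCompactSupport_partialDeriv (hc : HasCompactSupport f) (μ : Fin 4) :
    HasCompactSupport (partialDeriv μ f) := hc.fderiv_apply ℝ _

theorem norm_le_sum_abs (k : Space) : ‖k‖ ≤ ∑ i, |k i| := by
  have : ∑ i, |k i| ^ 2 ≤ (∑ i, |k i|) ^ 2 :=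
    Finset.sum_sq_le_sq_sum_of_nonneg fun i _ => abs_nonneg _
  rw [EuclideanSpace.norm_eq]
  refine Real.sqrt_le_iff.2 ⟨Finset.sum_nonneg fun i _ => abs_nonneg _, ?_⟩
  simpa [Real.norm_eq_abs] using this

/-- Rapid decay, uniformly in time. -/
theorem exists_sliceFourier_bound (hf : ContDiff ℝ ∞ f) (hc : HasCompactSupport f) (n : ℕ) :
    ∃ C : ℝ, 0 ≤ C ∧ ∀ q, (1 + ‖q.2‖) ^ n * ‖sliceFourier f q‖ ≤ C := by
  induction n generalizing f with
  | zero =>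
    obtain ⟨R, hR0, -, hR⟩ := exists_slice_radius hc
    obtain ⟨M, hM⟩ := hc.exists_bound_of_continuous hf.continuous
    have hM0 : 0 ≤ M := (norm_nonneg _).trans (hM 0)
    refine ⟨M * volume.real (Metric.closedBall (0 : Space) R), by positivity, fun q => ?_⟩
    rw [pow_zero, one_mul, sliceFourier]
    rw [← setIntegral_eq_integral_of_forall_compl_eq_zero (s := Metric.closedBall (0 : Space) R)]
    · refine norm_setIntegral_le_of_norm_le_const measure_closedBall_lt_top fun y _ => ?_
      rw [norm_smul, norm_exp_neg_I_mul, one_mul]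
      exact hM _
    · intro y hy
      rw [hR q.1 y (by simpa using hy), smul_zero]
  | succ n ih =>
    obtain ⟨C, hC0, hC⟩ := ih hf hc
    choose D hD0 hD using fun i : Fin 3 =>
      ih (contDiff_partialDeriv hf i.succ) (hasCompactSupport_partialDeriv hc i.succ)
    refine ⟨C + ∑ i, D i, add_nonneg hC0 (Finset.sum_nonneg fun i _ => hD0 i), fun q => ?_⟩
    have h1 : ∀ i : Fin 3, (1 + ‖q.2‖) ^ n * (|q.2 i| * ‖sliceFourier f q‖) ≤ D i := by
      intro i
      have := hD i q
      rw [sliceFourier_partialDeriv (hf.of_le (by norm_cast)) hc, norm_smul, norm_mul, Complex.norm_I,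
        one_mul, Complex.norm_real, Real.norm_eq_abs] at this
      exact this
    calc (1 + ‖q.2‖) ^ (n + 1) * ‖sliceFourier f q‖
        = (1 + ‖q.2‖) ^ n * ‖sliceFourier f q‖ +
          (1 + ‖q.2‖) ^ n * (‖q.2‖ * ‖sliceFourier f q‖) := by ring
      _ ≤ (1 + ‖q.2‖) ^ n * ‖sliceFourier f q‖ +
          (1 + ‖q.2‖) ^ n * ((∑ i, |q.2 i|) * ‖sliceFourier f q‖) := by
        gcongr
        exact norm_le_sum_abs _
      _ = (1 + ‖q.2‖) ^ n * ‖sliceFourier f q‖ +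
          ∑ i, (1 + ‖q.2‖) ^ n * (|q.2 i| * ‖sliceFourier f q‖) := by
        rw [Finset.sum_mul, Finset.mul_sum]
      _ ≤ C + ∑ i, D i := add_le_add (hC q) (Finset.sum_le_sum fun i _ => h1 i)

/-! ### Moments of amplitudes built from test functions -/

/-- The exponent 4 exceeds the dimension 3. -/
theorem integrable_one_add_norm_pow_inv :
    Integrable fun k : Space => ((1 + ‖k‖) ^ 4)⁻¹ := by
  have h := integrable_one_add_norm (E := Space) (μ := volume) (r := 4) (by simp; norm_num)
  refine h.congr (Eventually.of_forall fun k => ?_)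
  have : (0 : ℝ) ≤ 1 + ‖k‖ := by positivity
  simp only
  rw [Real.rpow_neg this]
  norm_cast

/-- Rapid decay of order n + 4 absorbs the polynomial factor and leaves (1 + |k|)⁻⁴. In time f is
compactly supported, so local finiteness of ν suffices; point masses and Lebesgue measure are both
covered. -/
theorem integrable_of_sliceFourier_bound {E : Type*} [NormedAddCommGroup E] {ν : Measure ℝ}
    [IsLocallyFiniteMeasure ν] [SFinite ν] (hf : ContDiff ℝ ∞ f) (hc : HasCompactSupport f)
    {g : Spacetime → E} (hg : AEStronglyMeasurable g (ν.prod volume)) {B : ℝ} {n : ℕ} (hB : 0 ≤ B)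
    (hgB : ∀ q, ‖g q‖ ≤ B * (1 + ‖q.2‖) ^ n * ‖sliceFourier f q‖) :
    Integrable g (ν.prod volume) := by
  obtain ⟨R, hR0, hR, -⟩ := exists_slice_radius hc
  obtain ⟨C, hC0, hC⟩ := exists_sliceFourier_bound hf hc (n + 4)
  have h1 : Integrable ((Metric.closedBall (0 : ℝ) R).indicator fun _ => B * C) ν :=
    (integrable_indicator_iff measurableSet_closedBall).2
      (integrableOn_const (measure_closedBall_lt_top).ne)
  refine (h1.mul_prod integrable_one_add_norm_pow_inv).mono' hg (Eventually.of_forall fun q => ?_)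
  obtain ⟨s, k⟩ := q
  by_cases hs : R < |s|
  · have := hgB (s, k)
    rw [sliceFourier_eq_zero (fun y => hR s y hs), norm_zero, mul_zero] at this
    refine this.trans (mul_nonneg (Set.indicator_nonneg (fun _ _ => by positivity) _)
      (by positivity))
  · rw [Set.indicator_of_mem (by simpa using hs)]
    have hpos : 0 < (1 + ‖k‖) ^ 4 := by positivity
    rw [← div_eq_mul_inv, le_div_iff₀ hpos]
    calc ‖g (s, k)‖ * (1 + ‖k‖) ^ 4
        ≤ (B * (1 + ‖k‖) ^ n * ‖sliceFourier f (s, k)‖) * (1 + ‖k‖) ^ 4 := by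
          gcongr
          exact hgB (s, k)
      _ = B * ((1 + ‖k‖) ^ (n + 4) * ‖sliceFourier f (s, k)‖) := by ring
      _ ≤ B * C := by
          gcongr
          exact hC (s, k)

theorem integrable_of_sliceFourier_bound_slice {E : Type*} [NormedAddCommGroup E]
    (hf : ContDiff ℝ ∞ f) (hc : HasCompactSupport f) {s : ℝ}
    {g : Space → E} (hg : AEStronglyMeasurable g volume) {B : ℝ} {n : ℕ} (hB : 0 ≤ B)
    (hgB : ∀ k, ‖g k‖ ≤ B * (1 + ‖k‖) ^ n * ‖sliceFourier f (s, k)‖) :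
    Integrable g := by
  obtain ⟨C, hC0, hC⟩ := exists_sliceFourier_bound hf hc (n + 4)
  refine (integrable_one_add_norm_pow_inv.const_mul (B * C)).mono' hg
    (Eventually.of_forall fun k => ?_)
  have hpos : 0 < (1 + ‖k‖) ^ 4 := by positivity
  rw [← div_eq_mul_inv, le_div_iff₀ hpos]
  calc ‖g k‖ * (1 + ‖k‖) ^ 4
      ≤ (B * (1 + ‖k‖) ^ n * ‖sliceFourier f (s, k)‖) * (1 + ‖k‖) ^ 4 := by
        gcongr
        exact hgB k
    _ = B * ((1 + ‖k‖) ^ (n + 4) * ‖sliceFourier f (s, k)‖) := by ring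
    _ ≤ B * C := by
        gcongr
        exact hC (s, k)

end

/-! ### Plane wave solutions -/

/-- The phase `k·x - σ ω(k) t` of a plane wave of sign `σ`. -/
def waveCovector (m σ : ℝ) (k : Space) : Spacetime →L[ℝ] ℝ :=
  (innerSL ℝ k).comp (ContinuousLinearMap.snd ℝ ℝ Space) -
    (σ * energy m k) • ContinuousLinearMap.fst ℝ ℝ Space

/-- The spinor amplitude of the plane waves of sign `σ` in the propagator. -/
def waveMatrix (γ : Fin 4 → Matrix (Fin 4) (Fin 4) ℂ) (m σ : ℝ) (k : Space) :
    Matrix (Fin 4) (Fin 4) ℂ :=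
  (Complex.I / 2) • (γ 0 + ((σ / energy m k : ℝ) : ℂ) • ((m : ℂ) • 1 - slash γ fun i => k i))

section

variable {γ : Fin 4 → Matrix (Fin 4) (Fin 4) ℂ} {m σ : ℝ}

theorem waveCovector_apply (k : Space) (p : Spacetime) :
    waveCovector m σ k p = inner ℝ k p.2 - σ * energy m k * p.1 := by
  simp [waveCovector]

theorem energy_nonneg (k : Space) : 0 ≤ energy m k := Real.sqrt_nonneg _

theorem energy_sq (k : Space) : energy m k ^ 2 = ‖k‖ ^ 2 + m ^ 2 :=
  Real.sq_sqrt (by positivity)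

theorem norm_le_energy (k : Space) : ‖k‖ ≤ energy m k :=
  Real.le_sqrt_of_sq_le (by nlinarith [sq_nonneg m])

theorem abs_le_energy (k : Space) : |m| ≤ energy m k :=
  Real.abs_le_sqrt (by nlinarith [sq_nonneg ‖k‖])

theorem energy_le (k : Space) : energy m k ≤ ‖k‖ + |m| := by
  refine Real.sqrt_le_iff.2 ⟨by positivity, ?_⟩
  nlinarith [norm_nonneg k, abs_nonneg m, sq_abs m]

theorem continuous_energy : Continuous (energy m) := by
  unfold energy
  fun_prop

theorem sum_sq_eq (k : Space) : ∑ i, k i ^ 2 = ‖k‖ ^ 2 := by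
  rw [EuclideanSpace.norm_sq_eq]
  simp

theorem continuous_waveCovector : Continuous (waveCovector m σ) := by
  unfold waveCovector
  have h1 : Continuous fun k : Space => innerSL ℝ k := (innerSL ℝ).continuous
  have h2 := continuous_energy (m := m)
  fun_prop

theorem norm_waveCovector_le (hσ : |σ| ≤ 1) (k : Space) :
    ‖waveCovector m σ k‖ ≤ (2 + |m|) * (1 + ‖k‖) := by
  refine ContinuousLinearMap.opNorm_le_bound _ (by positivity) fun p => ?_
  rw [waveCovector_apply]
  have h1 : |inner ℝ k p.2| ≤ ‖k‖ * ‖p‖ :=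
    (abs_real_inner_le_norm _ _).trans (by gcongr; exact norm_snd_le p)
  have h2 : |σ * energy m k * p.1| ≤ (‖k‖ + |m|) * ‖p‖ := by
    rw [abs_mul, abs_mul, abs_of_nonneg (energy_nonneg k)]
    have h3 : |p.1| ≤ ‖p‖ := norm_fst_le p
    have h4 := energy_le (m := m) k
    have h5 := energy_nonneg (m := m) k
    calc |σ| * energy m k * |p.1| ≤ 1 * (‖k‖ + |m|) * ‖p‖ := by gcongr
      _ = _ := by ring
  calc ‖inner ℝ k p.2 - σ * energy m k * p.1‖ ≤ |inner ℝ k p.2| + |σ * energy m k * p.1| :=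
        abs_sub _ _
    _ ≤ ‖k‖ * ‖p‖ + (‖k‖ + |m|) * ‖p‖ := add_le_add h1 h2
    _ ≤ (2 + |m|) * (1 + ‖k‖) * ‖p‖ := by
        have : 0 ≤ |m| * ‖k‖ * ‖p‖ := by positivity
        nlinarith [norm_nonneg p]

/-- Put P = −σωγ⁰ + γ^i k_i. The Clifford relations give P² = ω² − |k|² = m², and for ω ≠ 0 the
amplitude is a multiple of m − P, so the product is a multiple of (P + m)(m − P) = 0. -/
theorem IsDiracMatrices.dispersion (hγ : IsDiracMatrices γ) (hσ : σ ^ 2 = 1) (k : Space) :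
    (((-(σ * energy m k) : ℝ) : ℂ) • γ 0 + slash γ (fun i => k i) + (m : ℂ) • 1) *
      waveMatrix γ m σ k = 0 := by
  set K := slash γ (fun i => k i) with hKdef
  have hK : K * γ 0 = -(γ 0 * K) := hγ.slash_mul_zero _
  have hKK : K * K = (-((‖k‖ ^ 2 : ℝ) : ℂ)) • 1 := by
    rw [hKdef, hγ.slash_mul_slash, sum_sq_eq]
  rw [waveMatrix, ← hKdef, mul_smul_comm]
  suffices h : (((-(σ * energy m k) : ℝ) : ℂ) • γ 0 + K + (m : ℂ) • 1) *
      (γ 0 + ((σ / energy m k : ℝ) : ℂ) • ((m : ℂ) • 1 - K)) = 0 by rw [h, smul_zero]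
  have hexp : (((-(σ * energy m k) : ℝ) : ℂ) • γ 0 + K + (m : ℂ) • 1) *
      (γ 0 + ((σ / energy m k : ℝ) : ℂ) • ((m : ℂ) • 1 - K)) =
      ((-(σ * energy m k) + σ / energy m k * (m ^ 2 + ‖k‖ ^ 2) : ℝ) : ℂ) • 1 +
        (((1 - σ * energy m k * (σ / energy m k)) * m : ℝ) : ℂ) • γ 0 -
        ((1 - σ * energy m k * (σ / energy m k) : ℝ) : ℂ) • (γ 0 * K) := by
    simp only [add_mul, mul_add, mul_sub, smul_mul_assoc, mul_smul_comm, mul_one, one_mul, hK,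
      hγ.zero_mul_zero, hKK, smul_sub]
    push_cast
    module
  rw [hexp]
  -- If ω = 0 then m = 0 and k = 0, and σ/ω is 0 by convention; every coefficient that survives
  -- multiplies m or `K`, both zero.
  rcases eq_or_ne (energy m k) 0 with h0 | h0
  · have hm : m = 0 := abs_nonpos_iff.1 (h0 ▸ abs_le_energy k)
    have hk : k = 0 := norm_le_zero_iff.1 (h0 ▸ norm_le_energy (m := m) k)
    have hK0 : K = 0 := by simp [hKdef, slash, hk]
    rw [h0]
    simp [hm, hK0]
  · have h1 : σ * energy m k * (σ / energy m k) = 1 := by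
      field_simp
      exact hσ
    have h2 : -(σ * energy m k) + σ / energy m k * (m ^ 2 + ‖k‖ ^ 2) = 0 := by
      rw [add_comm (m ^ 2), ← energy_sq]
      field_simp
      ring
    rw [h1, h2]
    simp

theorem mulVec_integral {α : Type*} [MeasurableSpace α] {μ : Measure α} {g : α → Spinor}
    (hg : Integrable g μ) (M : Matrix (Fin 4) (Fin 4) ℂ) :
    M *ᵥ ∫ a, g a ∂μ = ∫ a, M *ᵥ g a ∂μ :=
  ((Matrix.mulVecLin M).toContinuousLinearMap.integral_comp_comm hg).symm

theorem integrable_mulVec {α : Type*} [MeasurableSpace α] {μ : Measure α} {g : α → Spinor}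
    (hg : Integrable g μ) (M : Matrix (Fin 4) (Fin 4) ℂ) : Integrable (fun a => M *ᵥ g a) μ :=
  (Matrix.mulVecLin M).toContinuousLinearMap.integrable_comp hg

/-- On a plane wave with phase θ the operator −iγ^μ∂_μ + m acts as the matrix γ^μθ_μ + m. The
hypothesis says that this symbol annihilates each amplitude. -/
theorem HasMoments.diracOp_eq_zero {α : Type*} [MeasurableSpace α] {μ : Measure α}
    {θ : α → Spacetime →L[ℝ] ℝ} {g : α → Spinor} (h : HasMoments μ θ g)
    (hg : ∀ a, ((θ a (1, 0) : ℝ) : ℂ) • (γ 0 *ᵥ g a) +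
      ∑ i : Fin 3, ((θ a (0, EuclideanSpace.single i 1) : ℝ) : ℂ) • (γ i.succ *ᵥ g a) +
      (m : ℂ) • g a = 0) (p : Spacetime) : diracOp γ m (planeWaves μ θ g) p = 0 := by
  rw [diracOp_eq]
  simp only [h.fderiv_apply]
  have hi := fun v => (h.directional v).integrable_wave p
  simp only [planeWaves]
  rw [mulVec_integral (hi _)]
  simp only [mulVec_integral (hi _)]
  rw [← integral_finsetSum _ fun i _ => integrable_mulVec (hi _) _,
    ← integral_add (integrable_mulVec (hi _) _)
      (integrable_finsetSum _ fun i _ => integrable_mulVec (hi _) _),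
    ← integral_smul, ← integral_smul, ← integral_add]
  · refine integral_eq_zero_of_ae (Eventually.of_forall fun a => ?_)
    have := congrArg (fun v => Complex.exp (Complex.I * ((θ a p : ℝ) : ℂ)) • v) (hg a)
    simp only [smul_zero] at this
    rw [Pi.zero_apply, ← this]
    simp only [Matrix.mulVec_smul, smul_add, Finset.smul_sum, smul_smul]
    congr 2
    · congr 1
      linear_combination (-(Complex.exp (Complex.I * ((θ a p : ℝ) : ℂ)) *
        ((θ a (1, 0) : ℝ) : ℂ))) * Complex.I_sq
    · refine Finset.sum_congr rfl fun i _ => ?_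
      congr 1
      linear_combination (-(Complex.exp (Complex.I * ((θ a p : ℝ) : ℂ)) *
        ((θ a (0, EuclideanSpace.single i 1) : ℝ) : ℂ))) * Complex.I_sq
    · exact mul_comm _ _
  · have hsum := (integrable_mulVec (hi (1, 0)) (γ 0)).add
      (integrable_finsetSum Finset.univ fun i _ =>
        integrable_mulVec (hi (0, EuclideanSpace.single i 1)) (γ (Fin.succ i)))
    exact hsum.smul (-Complex.I)
  · exact (h.integrable_wave p).smul (m : ℂ)

/-- Both |m| and |k_i| are at most ω, so the division by ω produces no singularity, even at k = 0 in
the massless case. -/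
theorem exists_norm_waveMatrix_mulVec_le (γ : Fin 4 → Matrix (Fin 4) (Fin 4) ℂ) (m : ℝ) :
    ∃ B : ℝ, 0 ≤ B ∧ ∀ σ : ℝ, |σ| ≤ 1 → ∀ (k : Space) (v : Spinor),
      ‖waveMatrix γ m σ k *ᵥ v‖ ≤ B * ‖v‖ := by
  set L : Fin 4 → Spinor →L[ℂ] Spinor := fun μ => (Matrix.mulVecLin (γ μ)).toContinuousLinearMap
  have hL : ∀ μ v, ‖γ μ *ᵥ v‖ ≤ ‖L μ‖ * ‖v‖ := fun μ v => (L μ).le_opNorm v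
  refine ⟨‖L 0‖ + (1 + ∑ i : Fin 3, ‖L i.succ‖), by positivity, fun σ hσ k v => ?_⟩
  have hdiv : ∀ a : ℝ, |a| ≤ energy m k → |σ / energy m k * a| ≤ 1 := by
    intro a ha
    rw [abs_mul, abs_div, abs_of_nonneg (energy_nonneg k), div_mul_eq_mul_div]
    refine div_le_one_of_le₀ ?_ (energy_nonneg k)
    calc |σ| * |a| ≤ 1 * energy m k := by gcongr
      _ = _ := one_mul _
  have hki : ∀ i, |k i| ≤ energy m k := fun i =>
    (PiLp.norm_apply_le k i).trans (norm_le_energy k)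
  have hexp : waveMatrix γ m σ k *ᵥ v = (Complex.I / 2) • (γ 0 *ᵥ v +
      (((σ / energy m k * m : ℝ) : ℂ) • v -
        ∑ i : Fin 3, ((σ / energy m k * k i : ℝ) : ℂ) • (γ i.succ *ᵥ v))) := by
    simp only [waveMatrix, slash, Matrix.smul_mulVec, Matrix.add_mulVec, Matrix.sub_mulVec,
      Matrix.one_mulVec, Matrix.sum_mulVec, smul_sub, Finset.smul_sum, smul_smul]
    push_cast
    rfl
  rw [hexp, norm_smul]
  have h2 : ‖(Complex.I / 2 : ℂ)‖ ≤ 1 := by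
    rw [norm_div, Complex.norm_I]; norm_num
  calc _ ≤ 1 * ‖γ 0 *ᵥ v + (((σ / energy m k * m : ℝ) : ℂ) • v -
        ∑ i : Fin 3, ((σ / energy m k * k i : ℝ) : ℂ) • (γ i.succ *ᵥ v))‖ := by gcongr
    _ ≤ ‖γ 0 *ᵥ v‖ + (‖((σ / energy m k * m : ℝ) : ℂ) • v‖ +
        ∑ i : Fin 3, ‖((σ / energy m k * k i : ℝ) : ℂ) • (γ i.succ *ᵥ v)‖) := by
        rw [one_mul]
        refine (norm_add_le _ _).trans (add_le_add le_rfl ?_)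
        exact (norm_sub_le _ _).trans (add_le_add le_rfl (norm_sum_le _ _))
    _ ≤ ‖L 0‖ * ‖v‖ + (1 * ‖v‖ + ∑ i : Fin 3, 1 * (‖L i.succ‖ * ‖v‖)) := by
        simp only [norm_smul, Complex.norm_real, Real.norm_eq_abs]
        gcongr with i
        · exact hL 0 v
        · exact hdiv m (abs_le_energy k)
        · exact hdiv _ (hki i)
        · exact hL _ v
    _ = _ := by
        simp only [one_mul, ← Finset.sum_mul]
        ring

theorem measurable_waveMatrix_mulVec {α : Type*} [MeasurableSpace α] {k : α → Space}
    {v : α → Spinor} (hk : Measurable k) (hv : Measurable v) :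
    Measurable fun a => waveMatrix γ m σ (k a) *ᵥ v a := by
  have he : Measurable fun a => energy m (k a) := continuous_energy.measurable.comp hk
  have hki : ∀ i, Measurable fun a => k a i := fun i => by
    exact (EuclideanSpace.proj (𝕜 := ℝ) i).continuous.measurable.comp hk
  have hvi : ∀ i, Measurable fun a => v a i := fun i => (measurable_pi_apply i).comp hv
  refine measurable_pi_lambda _ fun a => ?_
  simp only [Matrix.mulVec, dotProduct, waveMatrix, slash, Matrix.smul_apply, Matrix.add_apply,
    Matrix.sub_apply, Matrix.sum_apply, smul_eq_mul]
  fun_prop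

end

/-- The amplitude of the plane waves of sign `σ` emitted by the source `f` at time `q.1` with
wave vector `q.2`. -/
def waveAmplitude (γ : Fin 4 → Matrix (Fin 4) (Fin 4) ℂ) (m σ : ℝ) (f : Spacetime → Spinor)
    (q : Spacetime) : Spinor :=
  Complex.exp (Complex.I * ((σ * energy m q.2 * q.1 : ℝ) : ℂ)) •
    ((((2 * Real.pi) ^ 3)⁻¹ : ℝ) : ℂ) • (waveMatrix γ m σ q.2 *ᵥ sliceFourier f q)

/-- The field of the source `f`, with emission times weighted by `ν`. -/
def waveField (γ : Fin 4 → Matrix (Fin 4) (Fin 4) ℂ) (m : ℝ) (ν : Measure ℝ)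
    (f : Spacetime → Spinor) (p : Spacetime) : Spinor :=
  planeWaves (ν.prod volume) (fun q => waveCovector m 1 q.2) (waveAmplitude γ m 1 f) p +
    planeWaves (ν.prod volume) (fun q => waveCovector m (-1) q.2) (waveAmplitude γ m (-1) f) p

section

variable {γ : Fin 4 → Matrix (Fin 4) (Fin 4) ℂ} {m σ : ℝ} {f : Spacetime → Spinor}

theorem two_pi_cube_inv_le_one : ((2 * Real.pi) ^ 3)⁻¹ ≤ 1 := by
  apply inv_le_one_of_one_le₀
  apply one_le_pow₀
  have := Real.pi_gt_three
  linarith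

theorem measurable_waveAmplitude (hf : Continuous f) : Measurable (waveAmplitude γ m σ f) := by
  have h1 : Continuous fun q : Spacetime =>
      Complex.exp (Complex.I * ((σ * energy m q.2 * q.1 : ℝ) : ℂ)) := by
    have := continuous_energy (m := m)
    fun_prop
  exact h1.measurable.smul ((measurable_waveMatrix_mulVec measurable_snd
    (measurable_sliceFourier hf)).const_smul ((((2 * Real.pi) ^ 3)⁻¹ : ℝ) : ℂ))

theorem exists_norm_waveAmplitude_le (γ : Fin 4 → Matrix (Fin 4) (Fin 4) ℂ) (m : ℝ) :
    ∃ B : ℝ, 0 ≤ B ∧ ∀ (σ : ℝ), |σ| ≤ 1 → ∀ (f : Spacetime → Spinor) (q : Spacetime),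
      ‖waveAmplitude γ m σ f q‖ ≤ B * ‖sliceFourier f q‖ := by
  obtain ⟨B, hB0, hB⟩ := exists_norm_waveMatrix_mulVec_le γ m
  refine ⟨B, hB0, fun σ hσ f q => ?_⟩
  rw [waveAmplitude, norm_smul, norm_exp_I_mul, one_mul, norm_smul, Complex.norm_real,
    Real.norm_of_nonneg (by positivity)]
  calc _ ≤ 1 * (B * ‖sliceFourier f q‖) := by
        gcongr
        · exact two_pi_cube_inv_le_one
        · exact hB σ hσ _ _
    _ = _ := one_mul _

theorem hasMoments_waveAmplitude {ν : Measure ℝ} [IsLocallyFiniteMeasure ν] [SFinite ν]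
    (hf : ContDiff ℝ ∞ f) (hc : HasCompactSupport f) (hσ : |σ| ≤ 1) :
    HasMoments (ν.prod volume) (fun q => waveCovector m σ q.2) (waveAmplitude γ m σ f) := by
  obtain ⟨B, hB0, hB⟩ := exists_norm_waveAmplitude_le γ m
  have hθ : Continuous fun q : Spacetime => waveCovector m σ q.2 :=
    continuous_waveCovector.comp continuous_snd
  refine ⟨hθ.aestronglyMeasurable, fun n => ?_⟩
  refine integrable_of_sliceFourier_bound (B := (2 + |m|) ^ n * B) (n := n) hf hc
    ((hθ.norm.pow n).aestronglyMeasurable.smul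
      (measurable_waveAmplitude hf.continuous).stronglyMeasurable.aestronglyMeasurable)
    (by positivity) fun q => ?_
  rw [norm_smul, norm_pow, norm_norm]
  calc ‖waveCovector m σ q.2‖ ^ n * ‖waveAmplitude γ m σ f q‖
      ≤ ((2 + |m|) * (1 + ‖q.2‖)) ^ n * (B * ‖sliceFourier f q‖) := by
        gcongr
        · exact norm_waveCovector_le hσ _
        · exact hB σ hσ f q
    _ = _ := by rw [mul_pow]; ring

theorem abs_sign_le : |(1 : ℝ)| ≤ 1 ∧ |(-1 : ℝ)| ≤ 1 := by simp

theorem contDiff_waveField {ν : Measure ℝ} [IsLocallyFiniteMeasure ν] [SFinite ν]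
    (hf : ContDiff ℝ ∞ f) (hc : HasCompactSupport f) : ContDiff ℝ ∞ (waveField γ m ν f) :=
  (hasMoments_waveAmplitude hf hc abs_sign_le.1).contDiff.add
    (hasMoments_waveAmplitude hf hc abs_sign_le.2).contDiff

theorem IsDiracMatrices.diracOp_planeWaves (hγ : IsDiracMatrices γ) {ν : Measure ℝ}
    [IsLocallyFiniteMeasure ν] [SFinite ν] (hf : ContDiff ℝ ∞ f) (hc : HasCompactSupport f)
    (hσ : |σ| ≤ 1) (hσ' : σ ^ 2 = 1) (p : Spacetime) :
    diracOp γ m (planeWaves (ν.prod volume) (fun q => waveCovector m σ q.2)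
      (waveAmplitude γ m σ f)) p = 0 := by
  refine (hasMoments_waveAmplitude hf hc hσ).diracOp_eq_zero (fun q => ?_) p
  have h := congrArg (fun M => M *ᵥ sliceFourier f q) (hγ.dispersion (m := m) hσ' q.2)
  simp only [← Matrix.mulVec_mulVec, Matrix.zero_mulVec] at h
  set w := waveMatrix γ m σ q.2 *ᵥ sliceFourier f q with hw
  have h' : ((-(σ * energy m q.2) : ℝ) : ℂ) • (γ 0 *ᵥ w) +
      ∑ i : Fin 3, ((q.2 i : ℝ) : ℂ) • (γ i.succ *ᵥ w) + (m : ℂ) • w = 0 := by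
    rw [← h]
    simp only [slash, Matrix.add_mulVec, Matrix.smul_mulVec, Matrix.sum_mulVec, Matrix.one_mulVec]
  have h0 : waveCovector m σ q.2 (1, 0) = -(σ * energy m q.2) := by
    simp [waveCovector_apply]
  have hi : ∀ i : Fin 3, waveCovector m σ q.2 (0, EuclideanSpace.single i 1) = q.2 i := by
    intro i
    simp [waveCovector_apply, EuclideanSpace.inner_single_right]
  simp only [h0, hi]
  have h'' := congrArg (fun v => (Complex.exp (Complex.I * ((σ * energy m q.2 * q.1 : ℝ) : ℂ)) *
    ((((2 * Real.pi) ^ 3)⁻¹ : ℝ) : ℂ)) • v) h'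
  simp only [smul_zero] at h''
  rw [← h'', waveAmplitude, ← hw, smul_smul]
  simp only [Matrix.mulVec_smul, smul_add, Finset.smul_sum]
  refine congrArg₂ (· + ·) (congrArg₂ (· + ·) ?_ (Finset.sum_congr rfl fun i _ => ?_)) ?_ <;>
  exact smul_comm _ _ _

theorem IsDiracMatrices.diracOp_waveField (hγ : IsDiracMatrices γ) {ν : Measure ℝ}
    [IsLocallyFiniteMeasure ν] [SFinite ν] (hf : ContDiff ℝ ∞ f) (hc : HasCompactSupport f)
    (p : Spacetime) : diracOp γ m (waveField γ m ν f) p = 0 := by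
  have h1 := (hasMoments_waveAmplitude (γ := γ) (m := m) (ν := ν) hf hc abs_sign_le.1).contDiff
  have h2 := (hasMoments_waveAmplitude (γ := γ) (m := m) (ν := ν) hf hc abs_sign_le.2).contDiff
  have := diracOp_add (γ := γ) (m := m) (h1.differentiable (by simp))
    (h2.differentiable (by simp)) p
  rw [hγ.diracOp_planeWaves hf hc abs_sign_le.1 (by norm_num),
    hγ.diracOp_planeWaves hf hc abs_sign_le.2 (by norm_num), add_zero] at this
  exact this

theorem planeWaves_dirac (hf : ContDiff ℝ ∞ f) (hc : HasCompactSupport f) (hσ : |σ| ≤ 1) (s : ℝ)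
    (p : Spacetime) :
    planeWaves ((Measure.dirac s).prod volume) (fun q => waveCovector m σ q.2)
      (waveAmplitude γ m σ f) p =
    ∫ k, Complex.exp (Complex.I * ((waveCovector m σ k p : ℝ) : ℂ)) •
      waveAmplitude γ m σ f (s, k) := by
  rw [planeWaves, integral_prod _ ((hasMoments_waveAmplitude hf hc hσ).integrable_wave p),
    integral_dirac]

theorem waveField_volume (hf : ContDiff ℝ ∞ f) (hc : HasCompactSupport f) (p : Spacetime) :
    waveField γ m volume f p = ∫ s, waveField γ m (Measure.dirac s) f p := by
  have h1 := (hasMoments_waveAmplitude (γ := γ) (m := m) (ν := volume) hf hc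
    abs_sign_le.1).integrable_wave p
  have h2 := (hasMoments_waveAmplitude (γ := γ) (m := m) (ν := volume) hf hc
    abs_sign_le.2).integrable_wave p
  simp only [waveField, planeWaves_dirac hf hc abs_sign_le.1, planeWaves_dirac hf hc abs_sign_le.2]
  rw [integral_add h1.integral_prod_left h2.integral_prod_left, planeWaves, planeWaves,
    integral_prod _ h1, integral_prod _ h2]

theorem exp_mul_exp_wave (k x : Space) (s t : ℝ) :
    Complex.exp (Complex.I * ((waveCovector m σ k (t, x) : ℝ) : ℂ)) *
      Complex.exp (Complex.I * ((σ * energy m k * s : ℝ) : ℂ)) =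
    Complex.exp (-(Complex.I * ((σ * ((t - s) * energy m k) : ℝ) : ℂ))) *
      Complex.exp (Complex.I * ((inner ℝ k x : ℝ) : ℂ)) := by
  rw [← Complex.exp_add, ← Complex.exp_add, waveCovector_apply]
  congr 1
  push_cast
  ring

/-- Euler's formula: the part of `waveMatrix` even in σ produces the cosine, the odd part produces
sin/ω. The right-hand side is the Fourier multiplier of S(τ, ·). -/
theorem waveMatrix_add (τ : ℝ) (k : Space) :
    Complex.exp (-(Complex.I * ((1 * (τ * energy m k) : ℝ) : ℂ))) • waveMatrix γ m 1 k +
      Complex.exp (-(Complex.I * ((-1 * (τ * energy m k) : ℝ) : ℂ))) • waveMatrix γ m (-1) k =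
    (Complex.I * ((Real.cos (τ * energy m k) : ℝ) : ℂ)) • γ 0 +
      ((Real.sin (τ * energy m k) / energy m k : ℝ) : ℂ) •
        ((m : ℂ) • 1 - slash γ fun i => k i) := by
  have h1 : Complex.exp (-(Complex.I * ((1 * (τ * energy m k) : ℝ) : ℂ))) =
      Real.cos (τ * energy m k) - Real.sin (τ * energy m k) * Complex.I := by
    rw [one_mul, ← mul_neg, mul_comm, ← Complex.ofReal_neg, Complex.exp_mul_I,
      ← Complex.ofReal_cos, ← Complex.ofReal_sin, Real.cos_neg, Real.sin_neg]
    push_cast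
    ring
  have h2 : Complex.exp (-(Complex.I * ((-1 * (τ * energy m k) : ℝ) : ℂ))) =
      Real.cos (τ * energy m k) + Real.sin (τ * energy m k) * Complex.I := by
    rw [neg_one_mul, Complex.ofReal_neg, mul_neg, neg_neg, mul_comm, Complex.exp_mul_I,
      ← Complex.ofReal_cos, ← Complex.ofReal_sin]
  rw [h1, h2, waveMatrix, waveMatrix]
  set c : ℂ := ((Real.cos (τ * energy m k) : ℝ) : ℂ)
  rw [Complex.ofReal_div, Complex.ofReal_div, Complex.ofReal_div]
  set S : ℂ := ((Real.sin (τ * energy m k) : ℝ) : ℂ)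
  set W := (m : ℂ) • (1 : Matrix (Fin 4) (Fin 4) ℂ) - slash γ fun i => k i
  have e1 : (c - S * Complex.I) * (Complex.I / 2) + (c + S * Complex.I) * (Complex.I / 2) =
      Complex.I * c := by ring
  have e2 : (c - S * Complex.I) * (Complex.I / 2) * (((1 : ℝ) : ℂ) / (energy m k : ℂ)) +
      (c + S * Complex.I) * (Complex.I / 2) * (((-1 : ℝ) : ℂ) / (energy m k : ℂ)) =
      S / (energy m k : ℂ) := by
    push_cast
    linear_combination (-(S / (energy m k : ℂ))) * Complex.I_sq
  rw [← e1, ← e2]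
  module

/-- Combination of both signs into a single integral over the wave vectors. -/
theorem waveField_dirac (hf : ContDiff ℝ ∞ f) (hc : HasCompactSupport f) (s t : ℝ) (x : Space) :
    waveField γ m (Measure.dirac s) f (t, x) =
      ∫ k, ((((2 * Real.pi) ^ 3)⁻¹ : ℝ) : ℂ) •
        (((Complex.I * ((Real.cos ((t - s) * energy m k) : ℝ) : ℂ)) • γ 0 +
          ((Real.sin ((t - s) * energy m k) / energy m k : ℝ) : ℂ) •
            ((m : ℂ) • 1 - slash γ fun i => k i)) *ᵥ
          (Complex.exp (Complex.I * ((inner ℝ k x : ℝ) : ℂ)) • sliceFourier f (s, k))) := by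
  have hint : ∀ {σ : ℝ}, |σ| ≤ 1 →
      Integrable fun k => Complex.exp (Complex.I * ((waveCovector m σ k (t, x) : ℝ) : ℂ)) •
      waveAmplitude γ m σ f (s, k) := by
    intro σ hσ
    obtain ⟨B, hB0, hB⟩ := exists_norm_waveAmplitude_le γ m
    have hm : Measurable fun k => waveAmplitude γ m σ f (s, k) :=
      (measurable_waveAmplitude hf.continuous).comp measurable_prodMk_left
    have hθ : Continuous fun k =>
        Complex.exp (Complex.I * ((waveCovector m σ k (t, x) : ℝ) : ℂ)) := by
      have := continuous_waveCovector (m := m) (σ := σ)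
      fun_prop
    refine integrable_of_sliceFourier_bound_slice (B := B) (n := 0) (s := s) hf hc
      (hθ.aestronglyMeasurable.smul hm.stronglyMeasurable.aestronglyMeasurable) hB0 fun k => ?_
    rw [norm_smul, norm_exp_I_mul, one_mul, pow_zero, mul_one]
    exact hB σ hσ f (s, k)
  rw [waveField, planeWaves_dirac hf hc abs_sign_le.1, planeWaves_dirac hf hc abs_sign_le.2,
    ← integral_add (hint abs_sign_le.1) (hint abs_sign_le.2)]
  refine integral_congr_ae (Eventually.of_forall fun k => ?_)
  simp only [waveAmplitude, smul_smul]
  rw [← waveMatrix_add]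
  simp only [← mul_assoc, exp_mul_exp_wave, Matrix.add_mulVec, Matrix.smul_mulVec,
    Matrix.mulVec_smul, smul_add, smul_smul]
  congr 2 <;> ring

/-- Inversion for the normalization with exp(−2πi ξ·y), after substituting k = 2πξ; the Jacobian on
ℝ³ is the factor (2π)⁻³. -/
theorem fourier_inversion {φ : Space → Spinor} (hφ : Continuous φ) (hi : Integrable φ)
    (hF : Integrable fun k : Space =>
      ∫ y, Complex.exp (-(Complex.I * ((inner ℝ k y : ℝ) : ℂ))) • φ y) (x : Space) :
    ∫ k : Space, ((((2 * Real.pi) ^ 3)⁻¹ : ℝ) : ℂ) •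
      Complex.exp (Complex.I * ((inner ℝ k x : ℝ) : ℂ)) •
        ∫ y, Complex.exp (-(Complex.I * ((inner ℝ k y : ℝ) : ℂ))) • φ y = φ x := by
  set F : Space → Spinor := fun k =>
    ∫ y, Complex.exp (-(Complex.I * ((inner ℝ k y : ℝ) : ℂ))) • φ y with hFdef
  have h2π : (2 * Real.pi : ℝ) ≠ 0 := by positivity
  have hFour : FourierTransform.fourier φ = fun ξ => F ((2 * Real.pi) • ξ) := by
    funext ξ
    rw [Real.fourier_eq']
    refine integral_congr_ae (Eventually.of_forall fun y => ?_)
    simp only [inner_smul_left, real_inner_comm ξ y]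
    congr 2
    simp
    ring
  have hint : Integrable (FourierTransform.fourier φ) := by
    rw [hFour]
    exact hF.comp_smul h2π
  have hinv := congrFun (hφ.fourierInv_fourier_eq hi hint) x
  rw [Real.fourierInv_eq', hFour] at hinv
  rw [← hinv, integral_smul]
  have hcs := Measure.integral_comp_smul (volume : Measure Space)
    (fun k => Complex.exp (Complex.I * ((inner ℝ k x : ℝ) : ℂ)) • F k) (2 * Real.pi)
  have habs : |((2 * Real.pi) ^ 3)⁻¹| = ((2 * Real.pi) ^ 3)⁻¹ := abs_of_pos (by positivity)
  rw [finrank_euclideanSpace_fin, habs, real_smul_eq_coe_smul] at hcs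
  rw [← hcs]
  refine integral_congr_ae (Eventually.of_forall fun ξ => ?_)
  simp only [inner_smul_left]
  congr 2
  simp
  ring

theorem integrable_sliceFourier (hf : ContDiff ℝ ∞ f) (hc : HasCompactSupport f) (s : ℝ) :
    Integrable fun k => sliceFourier f (s, k) :=
  integrable_of_sliceFourier_bound_slice (B := 1) (n := 0) (s := s) hf hc
    ((measurable_sliceFourier hf.continuous).comp
      measurable_prodMk_left).stronglyMeasurable.aestronglyMeasurable zero_le_one fun k => by simp

/-- At zero elapsed time the multiplier is iγ⁰, that is, S(0, ·) = iγ⁰δ. -/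
theorem waveField_dirac_self (hf : ContDiff ℝ ∞ f) (hc : HasCompactSupport f) (s : ℝ)
    (x : Space) :
    waveField γ m (Measure.dirac s) f (s, x) = Complex.I • (γ 0 *ᵥ f (s, x)) := by
  have h : ∫ k : Space, ((((2 * Real.pi) ^ 3)⁻¹ : ℝ) : ℂ) •
      Complex.exp (Complex.I * ((inner ℝ k x : ℝ) : ℂ)) • sliceFourier f (s, k) = f (s, x) :=
    fourier_inversion (φ := fun y => f (s, y)) (hf.continuous.comp (by fun_prop))
    ((hf.continuous.comp (by fun_prop)).integrable_of_hasCompactSupport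
      (hasCompactSupport_slice hc s)) (integrable_sliceFourier hf hc s) x
  have hi : Integrable fun k : Space => ((((2 * Real.pi) ^ 3)⁻¹ : ℝ) : ℂ) •
      Complex.exp (Complex.I * ((inner ℝ k x : ℝ) : ℂ)) • sliceFourier f (s, k) := by
    suffices h0 : Integrable fun k : Space =>
        Complex.exp (Complex.I * ((inner ℝ k x : ℝ) : ℂ)) • sliceFourier f (s, k) from
      h0.smul ((((2 * Real.pi) ^ 3)⁻¹ : ℝ) : ℂ)
    refine (integrable_sliceFourier hf hc s).mono ?_ (Eventually.of_forall fun k => ?_)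
    · exact (by fun_prop : Continuous fun k : Space =>
        Complex.exp (Complex.I * ((inner ℝ k x : ℝ) : ℂ))).aestronglyMeasurable.smul
          (integrable_sliceFourier hf hc s).aestronglyMeasurable
    · rw [norm_smul, norm_exp_I_mul, one_mul]
  rw [waveField_dirac hf hc, ← h, mulVec_integral hi, ← integral_smul]
  refine integral_congr_ae (Eventually.of_forall fun k => ?_)
  simp [Matrix.smul_mulVec, Matrix.mulVec_smul, smul_smul, sliceFourier]
  ring_nf

end

/-! ### The propagator as a superposition of plane waves -/

section

variable {γ : Fin 4 → Matrix (Fin 4) (Fin 4) ℂ} {m : ℝ} {f : Spacetime → Spinor}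

theorem integral_exp_smul_reflect (φ : Space → Spinor) (k x : Space) :
    ∫ z, Complex.exp (Complex.I * ((inner ℝ k z : ℝ) : ℂ)) • φ (x - z) =
      Complex.exp (Complex.I * ((inner ℝ k x : ℝ) : ℂ)) •
        ∫ y, Complex.exp (-(Complex.I * ((inner ℝ k y : ℝ) : ℂ))) • φ y := by
  rw [← integral_sub_left_eq_self _ volume x, ← integral_smul]
  refine integral_congr_ae (Eventually.of_forall fun y => ?_)
  simp only [sub_sub_cancel, smul_smul, ← Complex.exp_add]
  rw [inner_sub_right]
  congr 2
  push_cast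
  ring

/-- From |sin(τω)| ≤ |τ|ω, the factor 1/ω is harmless uniformly in k, also for m = 0. -/
theorem abs_sin_div_energy_le (τ : ℝ) (k : Space) :
    |Real.sin (τ * energy m k) / ((2 * Real.pi) ^ 3 * energy m k)| ≤ |τ| := by
  have h1 : |Real.sin (τ * energy m k)| ≤ |τ| * energy m k := by
    have := Real.abs_sin_le_abs (x := τ * energy m k)
    rwa [abs_mul, abs_of_nonneg (energy_nonneg k)] at this
  rw [div_mul_eq_div_div_swap, abs_div, abs_div, abs_of_nonneg (energy_nonneg k)]
  have h2 : |Real.sin (τ * energy m k)| / energy m k ≤ |τ| :=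
    div_le_of_le_mul₀ (energy_nonneg k) (abs_nonneg _) h1
  have h3 : (1 : ℝ) ≤ |(2 * Real.pi) ^ 3| := by
    rw [abs_of_pos (by positivity)]
    apply one_le_pow₀
    have := Real.pi_gt_three
    linarith
  exact (div_le_self (by have := energy_nonneg (m := m) k; positivity) h3).trans h2

/-- The derivative in time of the Pauli-Jordan distribution. -/
theorem hasDerivAt_pauliJordan {φ : Space → Spinor}
    (hφ : Integrable fun k : Space =>
      ∫ x : Space, Complex.exp (Complex.I * ((inner ℝ k x : ℝ) : ℂ)) • φ x) (τ : ℝ) :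
    HasDerivAt (fun s => pauliJordan m s φ)
      (∫ k : Space, ((Real.cos (τ * energy m k) / (2 * Real.pi) ^ 3 : ℝ) : ℂ) •
        ∫ x : Space, Complex.exp (Complex.I * ((inner ℝ k x : ℝ) : ℂ)) • φ x) τ := by
  set Φ : Space → Spinor := fun k =>
    ∫ x : Space, Complex.exp (Complex.I * ((inner ℝ k x : ℝ) : ℂ)) • φ x with hΦ
  have hE := (continuous_energy (m := m)).measurable
  have hmeas : ∀ s : ℝ, AEStronglyMeasurable (fun k =>
      ((Real.sin (s * energy m k) / ((2 * Real.pi) ^ 3 * energy m k) : ℝ) : ℂ) • Φ k) volume := by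
    intro s
    have : Measurable fun k =>
        ((Real.sin (s * energy m k) / ((2 * Real.pi) ^ 3 * energy m k) : ℝ) : ℂ) := by
      fun_prop
    exact this.stronglyMeasurable.aestronglyMeasurable.smul hφ.aestronglyMeasurable
  have h := (hasDerivAt_integral_of_dominated_loc_of_deriv_le (μ := volume) (x₀ := τ)
    (F := fun s k =>
      ((Real.sin (s * energy m k) / ((2 * Real.pi) ^ 3 * energy m k) : ℝ) : ℂ) • Φ k)
    (F' := fun s k => ((Real.cos (s * energy m k) * energy m k /
      ((2 * Real.pi) ^ 3 * energy m k) : ℝ) : ℂ) • Φ k) (s := Set.univ)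
    (bound := fun k => ‖Φ k‖) univ_mem (Eventually.of_forall hmeas) ?_ ?_
    (Eventually.of_forall fun k s _ => ?_) hφ.norm (Eventually.of_forall fun k s _ => ?_)).2
  · refine h.congr_deriv (integral_congr_ae ?_)
    -- ω can vanish only at k = 0, a null set; there ω/ω would be 0 instead of 1.
    filter_upwards [volume.ae_ne (0 : Space)] with k hk
    have hpos : energy m k ≠ 0 := fun h0 => hk (norm_le_zero_iff.1 (h0 ▸ norm_le_energy (m := m) k))
    rw [mul_div_mul_right _ _ hpos]
  · refine (hφ.norm.const_mul |τ|).mono' (hmeas τ) (Eventually.of_forall fun k => ?_)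
    rw [norm_smul, Complex.norm_real, Real.norm_eq_abs]
    exact mul_le_mul_of_nonneg_right (abs_sin_div_energy_le τ k) (norm_nonneg _)
  · have : Measurable fun k => ((Real.cos (τ * energy m k) * energy m k /
        ((2 * Real.pi) ^ 3 * energy m k) : ℝ) : ℂ) := by
      fun_prop
    exact this.stronglyMeasurable.aestronglyMeasurable.smul hφ.aestronglyMeasurable
  · rw [norm_smul, Complex.norm_real, Real.norm_eq_abs]
    refine mul_le_of_le_one_left (norm_nonneg _) ?_
    rw [mul_div_mul_comm, abs_mul, abs_of_nonneg (div_nonneg (energy_nonneg k) (energy_nonneg k)),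
      div_eq_mul_inv (Real.cos _), abs_mul]
    refine mul_le_one₀ (mul_le_one₀ (Real.abs_cos_le_one _) (abs_nonneg _) ?_)
      (div_nonneg (energy_nonneg k) (energy_nonneg k)) (div_self_le_one _)
    rw [abs_of_pos (by positivity)]
    exact two_pi_cube_inv_le_one
  · have h1 : HasDerivAt (fun s : ℝ => Real.sin (s * energy m k) /
        ((2 * Real.pi) ^ 3 * energy m k)) (Real.cos (s * energy m k) * energy m k /
        ((2 * Real.pi) ^ 3 * energy m k)) s := by
      have := ((hasDerivAt_id s).mul_const (energy m k)).sin.div_const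
        ((2 * Real.pi) ^ 3 * energy m k)
      simpa using this
    exact h1.ofReal_comp.smul_const (Φ k)

/-- Testing against the reflected function z ↦ f(s, x − z) yields exp(ik·x) times the Fourier
transform of the slice. The time derivative turns sin/ω into the cosine, and the spatial derivatives
bring down k_i. -/
theorem propagatorSpaceConv_eq_integral (hf : ContDiff ℝ ∞ f) (hc : HasCompactSupport f)
    (s τ : ℝ) (x : Space) :
    propagatorSpaceConv γ m τ (fun y => f (s, y)) x =
      ∫ k, ((((2 * Real.pi) ^ 3)⁻¹ : ℝ) : ℂ) •
        (((Complex.I * ((Real.cos (τ * energy m k) : ℝ) : ℂ)) • γ 0 +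
          ((Real.sin (τ * energy m k) / energy m k : ℝ) : ℂ) •
            ((m : ℂ) • 1 - slash γ fun i => k i)) *ᵥ
          (Complex.exp (Complex.I * ((inner ℝ k x : ℝ) : ℂ)) • sliceFourier f (s, k))) := by
  set ψ : Space → Spinor := fun z => f (s, x - z) with hψ
  set Φ : Space → Spinor := fun k =>
    Complex.exp (Complex.I * ((inner ℝ k x : ℝ) : ℂ)) • sliceFourier f (s, k) with hΦ
  have hψ1 : ContDiff ℝ 1 ψ :=
    (hf.of_le (by norm_cast)).comp (contDiff_const.prodMk (contDiff_const.sub contDiff_id))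
  have hψc : HasCompactSupport ψ :=
    (hasCompactSupport_slice hc s).comp_homeomorph (Homeomorph.subLeft x)
  have hFψ : ∀ k, ∫ z, Complex.exp (Complex.I * ((inner ℝ k z : ℝ) : ℂ)) • ψ z = Φ k := fun k =>
    integral_exp_smul_reflect (fun y => f (s, y)) k x
  have hFdψ : ∀ i k, ∫ z, Complex.exp (Complex.I * ((inner ℝ k z : ℝ) : ℂ)) • spacePartial i ψ z =
      (-(Complex.I * ((k i : ℝ) : ℂ))) • Φ k := fun i k => by
    rw [integral_exp_smul_spacePartial hψ1 hψc, hFψ]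
  have hΦm : AEStronglyMeasurable Φ volume :=
    (by fun_prop : Continuous fun k : Space =>
        Complex.exp (Complex.I * ((inner ℝ k x : ℝ) : ℂ))).aestronglyMeasurable.smul
      (integrable_sliceFourier hf hc s).aestronglyMeasurable
  have hΦn : ∀ k, ‖Φ k‖ = ‖sliceFourier f (s, k)‖ := fun k => by
    rw [hΦ, norm_smul, norm_exp_I_mul, one_mul]
  have hΦi : Integrable Φ :=
    (integrable_sliceFourier hf hc s).mono hΦm (Eventually.of_forall fun k => (hΦn k).le)
  have hE := (continuous_energy (m := m)).measurable
  set a : Space → ℂ := fun k =>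
    ((Real.sin (τ * energy m k) / ((2 * Real.pi) ^ 3 * energy m k) : ℝ) : ℂ) with ha
  have ham : Measurable a := by rw [ha]; fun_prop
  have hbound : ∀ k, ‖a k‖ ≤ |τ| := fun k => by
    rw [ha, Complex.norm_real]
    exact abs_sin_div_energy_le τ k
  have haΦ : Integrable fun k => a k • Φ k :=
    (hΦi.norm.const_mul |τ|).mono' (ham.aestronglyMeasurable.smul hΦm)
      (Eventually.of_forall fun k => by
        rw [norm_smul]
        gcongr
        exact hbound k)
  have haiΦ : ∀ i : Fin 3, Integrable fun k => a k • (-(Complex.I * ((k i : ℝ) : ℂ))) • Φ k := by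
    intro i
    have hk : Continuous fun k : Space => -(Complex.I * ((k i : ℝ) : ℂ)) := by fun_prop
    refine integrable_of_sliceFourier_bound_slice (B := |τ|) (n := 1) (s := s) hf hc
      (ham.aestronglyMeasurable.smul (hk.aestronglyMeasurable.smul hΦm)) (abs_nonneg _) fun k => ?_
    have hki : ‖((k i : ℝ) : ℂ)‖ ≤ 1 + ‖k‖ := by
      rw [Complex.norm_real]
      linarith [PiLp.norm_apply_le k i]
    rw [norm_smul, norm_smul, norm_neg, norm_mul, Complex.norm_I, one_mul, hΦn, pow_one, mul_assoc]
    gcongr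
    exact hbound k
  have hcΦ : Integrable fun k =>
      ((Real.cos (τ * energy m k) / (2 * Real.pi) ^ 3 : ℝ) : ℂ) • Φ k := by
    have hm : Measurable fun k => ((Real.cos (τ * energy m k) / (2 * Real.pi) ^ 3 : ℝ) : ℂ) := by
      fun_prop
    refine hΦi.norm.mono' (hm.aestronglyMeasurable.smul hΦm) (Eventually.of_forall fun k => ?_)
    rw [norm_smul, Complex.norm_real, Real.norm_eq_abs, div_eq_mul_inv, abs_mul]
    refine mul_le_of_le_one_left (norm_nonneg _) (mul_le_one₀ (Real.abs_cos_le_one _)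
      (abs_nonneg _) ?_)
    rw [abs_of_pos (by positivity)]
    exact two_pi_cube_inv_le_one
  have hderiv := (hasDerivAt_pauliJordan (m := m) (φ := ψ) (by simpa only [hFψ] using hΦi) τ).deriv
  have hprop : propagatorSpaceConv γ m τ (fun y => f (s, y)) x = propagator γ m τ ψ := rfl
  rw [hprop, propagator, hderiv]
  simp only [pauliJordan, hFψ, hFdψ]
  rw [mulVec_integral hcΦ]
  simp only [← integral_neg]
  have hni : ∀ i : Fin 3, Integrable fun k : Space => -(((Real.sin (τ * energy m k) /
      ((2 * Real.pi) ^ 3 * energy m k) : ℝ) : ℂ) • (-(Complex.I * ((k i : ℝ) : ℂ))) • Φ k) :=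
    fun i => (haiΦ i).neg
  simp only [fun i => mulVec_integral (hni i) (γ (Fin.succ i))]
  have i1 := integrable_mulVec hcΦ (γ 0)
  have i2 := fun i : Fin 3 => integrable_mulVec (hni i) (γ i.succ)
  rw [← integral_finsetSum _ fun i _ => i2 i,
    ← integral_add i1 (integrable_finsetSum _ fun i _ => i2 i),
    ← integral_smul, ← integral_smul, ← integral_add]
  · refine integral_congr_ae (Eventually.of_forall fun k => ?_)
    have h1 : Real.cos (τ * energy m k) / (2 * Real.pi) ^ 3 =
        ((2 * Real.pi) ^ 3)⁻¹ * Real.cos (τ * energy m k) := by rw [div_eq_inv_mul]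
    have h2 : Real.sin (τ * energy m k) / ((2 * Real.pi) ^ 3 * energy m k) =
        ((2 * Real.pi) ^ 3)⁻¹ * (Real.sin (τ * energy m k) / energy m k) := by
      rw [div_mul_eq_div_div_swap, div_eq_inv_mul]
    change _ = ((((2 * Real.pi) ^ 3)⁻¹ : ℝ) : ℂ) • (_ *ᵥ Φ k)
    simp only [h1, h2]
    generalize Φ k = w
    rw [Complex.ofReal_mul, Complex.ofReal_mul]
    generalize ((((2 * Real.pi) ^ 3)⁻¹ : ℝ) : ℂ) = b
    generalize ((Real.cos (τ * energy m k) : ℝ) : ℂ) = C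
    generalize ((Real.sin (τ * energy m k) / energy m k : ℝ) : ℂ) = S
    simp only [slash, Matrix.add_mulVec, Matrix.smul_mulVec, Matrix.sub_mulVec, Matrix.one_mulVec,
      Matrix.sum_mulVec, Matrix.mulVec_smul, smul_add, smul_sub, Finset.smul_sum, smul_smul,
      neg_smul, smul_neg, neg_neg]
    -- One factor i belongs to iγ^i, the other to the Fourier transform of ∂_i; together they give
    -- the minus sign of γ^i k_i.
    have h3 : ∀ i : Fin 3, Complex.I * (b * S * (Complex.I * ((k i : ℝ) : ℂ))) =
        -(b * (S * ((k i : ℝ) : ℂ))) := fun i => by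
      linear_combination (b * S * ((k i : ℝ) : ℂ)) * Complex.I_sq
    simp only [h3, neg_smul, Finset.sum_neg_distrib]
    module
  · have := i1.add (integrable_finsetSum Finset.univ fun i _ => i2 i)
    exact this.smul Complex.I
  · exact haΦ.smul (m : ℂ)

theorem propagatorSpaceConv_eq_waveField (hf : ContDiff ℝ ∞ f) (hc : HasCompactSupport f)
    (s t : ℝ) (x : Space) :
    propagatorSpaceConv γ m (t - s) (fun y => f (s, y)) x =
      waveField γ m (Measure.dirac s) f (t, x) := by
  rw [propagatorSpaceConv_eq_integral hf hc, waveField_dirac hf hc]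

theorem propagatorConv_eq_waveField (hf : ContDiff ℝ ∞ f) (hc : HasCompactSupport f) :
    propagatorConv γ m f = waveField γ m volume f := by
  funext p
  rw [waveField_volume hf hc]
  exact integral_congr_ae (Eventually.of_forall fun s =>
    propagatorSpaceConv_eq_waveField hf hc s p.1 p.2)

end

/-! ### The Cauchy problem and the propagator -/

section

variable {γ : Fin 4 → Matrix (Fin 4) (Fin 4) ℂ} {m : ℝ} {f : Spacetime → Spinor}

theorem diracOp_smul {ζ : Spacetime → Spinor} (hζ : Differentiable ℝ ζ) (c : ℂ) (p : Spacetime) :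
    diracOp γ m (fun p => c • ζ p) p = c • diracOp γ m ζ p := by
  simp only [diracOp_eq, fderiv_fun_const_smul (hζ p), _root_.smul_apply, Matrix.mulVec_smul,
    ← Finset.smul_sum, ← smul_add]
  simp only [smul_smul, smul_add]
  congr 1
  · simp only [mul_comm c]
  · simp only [mul_comm c]

theorem IsDiracMatrices.zero_mulVec_zero_mulVec (hγ : IsDiracMatrices γ) (v : Spinor) :
    γ 0 *ᵥ (γ 0 *ᵥ v) = v := by
  rw [Matrix.mulVec_mulVec, hγ.zero_mul_zero, Matrix.one_mulVec]

theorem contDiff_mulVec {n : WithTop ℕ∞} (hf : ContDiff ℝ n f) (M : Matrix (Fin 4) (Fin 4) ℂ) :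
    ContDiff ℝ n fun p => M *ᵥ f p :=
  ((Matrix.mulVecLin M).toContinuousLinearMap.restrictScalars ℝ).contDiff.comp hf

/-- A solution is emitted by the source which reproduces its values at time `s`. -/
theorem IsDiracMatrices.waveField_dirac_eq (hγ : IsDiracMatrices γ) (hf : ContDiff ℝ ∞ f)
    (hc : HasCompactSupport f) {ζ : Spacetime → Spinor} (hζ : ContDiff ℝ ∞ ζ)
    (e : ∀ p, diracOp γ m ζ p = 0) {s : ℝ} {c : ℂ}
    (h : ∀ x, Complex.I • (γ 0 *ᵥ f (s, x)) = c • ζ (s, x)) (p : Spacetime) :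
    waveField γ m (Measure.dirac s) f p = c • ζ p := by
  have h1 : (1 : WithTop ℕ∞) ≤ ∞ := by norm_cast
  refine congrFun (hγ.eq_of_eq_slice (ζ₂ := fun p => c • ζ p) (s := s)
    ((contDiff_waveField hf hc).of_le h1) ((hζ.of_le h1).const_smul c)
    (hγ.diracOp_waveField hf hc) (fun p => ?_) fun x => ?_) p
  · rw [diracOp_smul (hζ.differentiable (by simp)), e, smul_zero]
  · rw [waveField_dirac_self hf hc, h]

theorem isCompact_slice_tsupport (hc : HasCompactSupport f) (s : ℝ) :
    IsCompact {y : Space | (s, y) ∈ tsupport f} := by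
  refine (hc.isCompact.image continuous_snd).of_isClosed_subset
    ((isClosed_tsupport f).preimage (by fun_prop : Continuous fun y : Space => (s, y)))
    fun y hy => ⟨(s, y), hy, rfl⟩

/-- At time s the field is iγ⁰f(s, ·), which vanishes off the slice of supp f, so finite propagation
speed applies. -/
theorem IsDiracMatrices.mem_causalShadow_of_waveField_dirac_ne_zero (hγ : IsDiracMatrices γ)
    (hf : ContDiff ℝ ∞ f) (hc : HasCompactSupport f) {s : ℝ} {p : Spacetime}
    (hp : waveField γ m (Measure.dirac s) f p ≠ 0) : p ∈ causalShadow (tsupport f) := by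
  have hmem := hγ.mem_causalShadow_of_ne_zero
    ((contDiff_waveField hf hc).of_le (by norm_cast)) (hγ.diracOp_waveField hf hc)
    (isCompact_slice_tsupport hc s) (s := s) (fun y hy => by
      rw [waveField_dirac_self hf hc, image_eq_zero_of_notMem_tsupport hy]
      simp) hp
  refine causalShadow_mono ?_ hmem
  rintro ⟨s', y⟩ ⟨rfl, hy⟩
  exact hy

theorem IsDiracMatrices.waveField_dirac_mem (hγ : IsDiracMatrices γ) (hf : ContDiff ℝ ∞ f)
    (hc : HasCompactSupport f) (s : ℝ) :
    waveField γ m (Measure.dirac s) f ∈ diracSolutions γ m :=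
  ⟨contDiff_waveField hf hc, ⟨tsupport f, hc.isCompact, closure_minimal
    (fun _ hp => hγ.mem_causalShadow_of_waveField_dirac_ne_zero hf hc hp)
    (isClosed_causalShadow hc.isCompact)⟩, hγ.diracOp_waveField hf hc⟩

theorem IsDiracMatrices.mem_causalShadow_of_propagatorConv_ne_zero (hγ : IsDiracMatrices γ)
    (hf : ContDiff ℝ ∞ f) (hc : HasCompactSupport f) {p : Spacetime}
    (hp : propagatorConv γ m f p ≠ 0) : p ∈ causalShadow (tsupport f) := by
  rw [propagatorConv_eq_waveField hf hc, waveField_volume hf hc] at hp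
  by_contra hmem
  refine hp (integral_eq_zero_of_ae (Eventually.of_forall fun s => ?_))
  by_contra hs
  exact hmem (hγ.mem_causalShadow_of_waveField_dirac_ne_zero hf hc hs)

theorem IsDiracMatrices.propagatorConv_mem (hγ : IsDiracMatrices γ) (hf : ContDiff ℝ ∞ f)
    (hc : HasCompactSupport f) : propagatorConv γ m f ∈ diracSolutions γ m := by
  refine ⟨?_, ⟨tsupport f, hc.isCompact, closure_minimal
    (fun _ hp => hγ.mem_causalShadow_of_propagatorConv_ne_zero hf hc hp)
    (isClosed_causalShadow hc.isCompact)⟩, ?_⟩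
  · rw [propagatorConv_eq_waveField hf hc]
    exact contDiff_waveField hf hc
  · rw [propagatorConv_eq_waveField hf hc]
    exact hγ.diracOp_waveField hf hc

/-- If K lies in the ball of radius r, then |x| ≤ r + |t − q⁰| ≤ |t| + 2r for the relevant q in K.
Space-compactness is used below only in this form. -/
theorem IsSpaceCompact.exists_bound {ζ : Spacetime → Spinor} (h : IsSpaceCompact ζ) :
    ∃ C : ℝ, ∀ p, ζ p ≠ 0 → ‖p.2‖ ≤ |p.1| + C := by
  obtain ⟨K, hK, hsub⟩ := h
  obtain ⟨r, hr⟩ := hK.isBounded.exists_norm_le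
  refine ⟨r + r, fun p hp => ?_⟩
  obtain ⟨q, hq, hqp⟩ := (mem_causalShadow_iff _ _).1 (hsub (subset_tsupport _ hp))
  have h1 : |q.1| ≤ r := (norm_fst_le q).trans (hr q hq)
  have h2 : ‖q.2‖ ≤ r := (norm_snd_le q).trans (hr q hq)
  have h3 := norm_sub_norm_le p.2 q.2
  have h4 := abs_sub p.1 q.1
  linarith

theorem IsDiracMatrices.exists_source (hγ : IsDiracMatrices γ) {ζ : Spacetime → Spinor}
    (hζ : ζ ∈ diracSolutions γ m) :
    ∃ f : Spacetime → Spinor, ContDiff ℝ ∞ f ∧ HasCompactSupport f ∧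
      ζ = propagatorConv γ m f := by
  obtain ⟨hζ1, hζ2, hζ3⟩ := hζ
  obtain ⟨C, hC⟩ := hζ2.exists_bound
  let b : ContDiffBump (0 : ℝ) := ⟨1, 2, one_pos, one_lt_two⟩
  set χ : ℝ → ℝ := b.normed volume with hχ
  have hχs : ContDiff ℝ ∞ χ := b.contDiff_normed
  have hχ1 : ∫ s, χ s = 1 := b.integral_normed
  have hχ0 : ∀ s, 2 < |s| → χ s = 0 := by
    intro s hs
    have : s ∉ tsupport (b.normed volume) := by
      rw [b.tsupport_normed_eq]
      simpa using hs
    exact image_eq_zero_of_notMem_tsupport this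
  set f : Spacetime → Spinor := fun p => (-(Complex.I * (χ p.1 : ℂ))) • (γ 0 *ᵥ ζ p) with hfdef
  have hχc : ContDiff ℝ ∞ fun p : Spacetime => -(Complex.I * (χ p.1 : ℂ)) :=
    (contDiff_const.mul (Complex.ofRealCLM.contDiff.comp (hχs.comp contDiff_fst))).neg
  have hf : ContDiff ℝ ∞ f := hχc.smul (contDiff_mulVec hζ1 (γ 0))
  have hc : HasCompactSupport f := by
    -- In the slab |t| ≤ 2 the bound |x| ≤ |t| + C confines ζ to |x| ≤ 2 + C.
    refine HasCompactSupport.intro ((isCompact_closedBall (0 : ℝ) 2).prod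
      (isCompact_closedBall (0 : Space) (2 + C))) fun p hp => ?_
    by_cases hs : 2 < |p.1|
    · simp [hfdef, hχ0 p.1 hs]
    · have : ζ p = 0 := by
        by_contra hne
        refine hp ⟨by simpa using hs, ?_⟩
        have := hC p hne
        rw [mem_closedBall_zero_iff]
        linarith
      simp [hfdef, this]
  refine ⟨f, hf, hc, ?_⟩
  rw [propagatorConv_eq_waveField hf hc]
  funext p
  rw [waveField_volume hf hc]
  have : ∀ s, waveField γ m (Measure.dirac s) f p = ((χ s : ℝ) : ℂ) • ζ p := by
    intro s
    -- The factor −iγ⁰ in the source cancels the iγ⁰ of the emitted data, since (γ⁰)² = 1, leaving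
    -- χ(s)ζ(s, ·).
    refine hγ.waveField_dirac_eq hf hc hζ1 hζ3 (fun x => ?_) p
    rw [hfdef, Matrix.mulVec_smul, hγ.zero_mulVec_zero_mulVec, smul_smul]
    congr 1
    linear_combination (-(χ s : ℂ)) * Complex.I_sq
  simp only [this]
  rw [integral_smul_const, integral_complex_ofReal, hχ1]
  simp

theorem IsDiracMatrices.cauchy_problem (hγ : IsDiracMatrices γ) {ϑ : Space → Spinor}
    (hϑ : ContDiff ℝ ∞ ϑ) (hc : HasCompactSupport ϑ) :
    (∃! ζ : Spacetime → Spinor, ζ ∈ diracSolutions γ m ∧ ∀ x, ζ (0, x) = ϑ x) ∧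
      ∀ ζ : Spacetime → Spinor, ζ ∈ diracSolutions γ m → (∀ x, ζ (0, x) = ϑ x) →
        tsupport ζ ⊆ causalShadow ({(0 : ℝ)} ×ˢ tsupport ϑ) ∧
        ∀ (t : ℝ) (x : Space), ζ (t, x) =
          (-Complex.I) • propagatorSpaceConv γ m t (fun y => γ 0 *ᵥ ϑ y) x := by
  have h1 : (1 : WithTop ℕ∞) ≤ ∞ := by norm_cast
  let b : ContDiffBump (0 : ℝ) := ⟨1, 2, one_pos, one_lt_two⟩
  -- A cutoff in time makes a spacetime test function out of βϑ; only its slice at time 0, where b =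
  -- 1, is emitted.
  set f : Spacetime → Spinor := fun p => ((b p.1 : ℝ) : ℂ) • (γ 0 *ᵥ ϑ p.2) with hfdef
  have hb0 : b 0 = 1 := b.one_of_mem_closedBall (by simp [b.rIn_pos.le])
  have hf0 : ∀ x, f (0, x) = γ 0 *ᵥ ϑ x := fun x => by simp [hfdef, hb0]
  have hbc : ContDiff ℝ ∞ fun p : Spacetime => ((b p.1 : ℝ) : ℂ) :=
    Complex.ofRealCLM.contDiff.comp (b.contDiff.comp contDiff_fst)
  have hf : ContDiff ℝ ∞ f :=
    hbc.smul (contDiff_mulVec (f := fun p => ϑ p.2) (hϑ.comp contDiff_snd) (γ 0))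
  have hfc : HasCompactSupport f := by
    refine HasCompactSupport.intro (b.hasCompactSupport.isCompact.prod hc.isCompact) fun p hp => ?_
    by_cases hs : p.1 ∈ tsupport b
    · have : p.2 ∉ tsupport ϑ := fun h => hp ⟨hs, h⟩
      simp [hfdef, image_eq_zero_of_notMem_tsupport this]
    · simp [hfdef, image_eq_zero_of_notMem_tsupport hs]
  have hw0 : ∀ x, waveField γ m (Measure.dirac 0) f (0, x) = Complex.I • ϑ x := fun x => by
    rw [waveField_dirac_self hf hfc, hf0, hγ.zero_mulVec_zero_mulVec]
  have hw := hγ.waveField_dirac_mem (m := m) hf hfc 0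
  have hsol : ∀ p, diracOp γ m
      (fun p => (-Complex.I) • waveField γ m (Measure.dirac 0) f p) p = 0 := fun p => by
    rw [diracOp_smul (hw.1.differentiable (by simp)), hw.2.2, smul_zero]
  have hsm : ContDiff ℝ ∞ fun p => (-Complex.I) • waveField γ m (Measure.dirac 0) f p :=
    hw.1.const_smul (-Complex.I)
  have hval : ∀ x, (-Complex.I) • waveField γ m (Measure.dirac 0) f (0, x) = ϑ x := fun x => by
    rw [hw0, smul_smul]
    simp
  have hsupp : ∀ ζ : Spacetime → Spinor, ContDiff ℝ ∞ ζ → (∀ p, diracOp γ m ζ p = 0) →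
      (∀ x, ζ (0, x) = ϑ x) → tsupport ζ ⊆ causalShadow ({(0 : ℝ)} ×ˢ tsupport ϑ) :=
    fun ζ hζ e h0 => hγ.tsupport_subset (hζ.of_le h1) e hc.isCompact fun y hy => by
      rw [h0, image_eq_zero_of_notMem_tsupport hy]
  refine ⟨⟨fun p => (-Complex.I) • waveField γ m (Measure.dirac 0) f p,
    ⟨⟨hsm, ⟨_, isCompact_singleton.prod hc.isCompact, hsupp _ hsm hsol hval⟩, hsol⟩, hval⟩, ?_⟩, ?_⟩
  · rintro ζ ⟨⟨hζ, -, e⟩, h0⟩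
    exact hγ.eq_of_eq_slice (hζ.of_le h1) (hsm.of_le h1) e hsol (s := 0)
      fun y => by rw [h0, hval]
  · rintro ζ ⟨hζ, -, e⟩ h0
    refine ⟨hsupp ζ hζ e h0, fun t x => ?_⟩
    have := congrFun (hγ.eq_of_eq_slice (hζ.of_le h1) (hsm.of_le h1) e hsol (s := 0)
      fun y => by rw [h0, hval]) (t, x)
    rw [this, ← propagatorSpaceConv_eq_waveField hf hfc]
    simp only [hf0, sub_zero]

end

/-! ### The scalar product does not depend on the hypersurface -/

/-- The graph of `h` meets the causal shadow of a bounded set in a bounded set. -/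
def IsTransversalToCones (h : Space → ℝ) : Prop :=
  ∀ C : ℝ, ∃ R : ℝ, ∀ x, ‖x‖ ≤ |h x| + C → ‖x‖ ≤ R

theorem isTransversalToCones_const (s : ℝ) : IsTransversalToCones fun _ => s :=
  fun C => ⟨|s| + C, fun _ hx => hx⟩

section

variable {γ : Fin 4 → Matrix (Fin 4) (Fin 4) ℂ} {m : ℝ} {h : Space → ℝ}
  {ζ₁ ζ₂ : Spacetime → Spinor}

theorem continuous_spacePartial (hh : ContDiff ℝ ∞ h) (i : Fin 3) :
    Continuous (spacePartial i h) := by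
  have := hh.continuous_fderiv (by simp)
  unfold spacePartial
  fun_prop

theorem integrable_fluxDensity (hh : ContDiff ℝ ∞ h) (ht : IsTransversalToCones h)
    (h₁ : ζ₁ ∈ diracSolutions γ m) (h₂ : ζ₂ ∈ diracSolutions γ m) :
    Integrable (fluxDensity γ h ζ₁ ζ₂) := by
  obtain ⟨C, hC⟩ := h₂.2.1.exists_bound
  obtain ⟨R, hR⟩ := ht C
  have hj := fun μ => (contDiff_current (γ := γ) h₁.1 h₂.1 μ).continuous
  have hd := continuous_spacePartial hh
  have hhc := hh.continuous
  refine integrable_of_eq_zero_of_lt (R := R) ?_ fun x hx => ?_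
  · unfold fluxDensity
    fun_prop
  · have : ζ₂ (h x, x) = 0 := by
      by_contra hne
      exact absurd (hR x (hC (h x, x) hne)) (not_le.2 hx)
    simp [fluxDensity, current, this]

theorem hasDerivAt_comp_graph {j : Spacetime → ℂ} (hj : Differentiable ℝ j) (x : Space) (r l : ℝ) :
    HasDerivAt (fun l => j (Real.sin l * r, x))
      (((Real.cos l * r : ℝ) : ℂ) * fderiv ℝ j (Real.sin l * r, x) (1, 0)) l := by
  have h1 := (hj (Real.sin l * r, x)).hasFDerivAt.comp_hasDerivAt l
    (((Real.hasDerivAt_sin l).mul_const r).prodMk (hasDerivAt_const l x))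
  refine h1.congr_deriv ?_
  have : ((Real.cos l * r, 0) : Spacetime) = (Real.cos l * r) • (1, 0) := by simp
  rw [this, map_smul, Complex.real_smul]

theorem spacePartial_mul_comp_graph {j : Spacetime → ℂ} (hj : Differentiable ℝ j)
    (hh : Differentiable ℝ h) (a b : ℝ) (x : Space) (i : Fin 3) :
    spacePartial i (fun y => ((b * h y : ℝ) : ℂ) * j (a * h y, y)) x =
      ((b * spacePartial i h x : ℝ) : ℂ) * j (a * h x, x) +
      ((b * h x : ℝ) : ℂ) * (((a * spacePartial i h x : ℝ) : ℂ) * fderiv ℝ j (a * h x, x) (1, 0) +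
        fderiv ℝ j (a * h x, x) (0, EuclideanSpace.single i 1)) := by
  have h0 := (hh x).hasFDerivAt
  have hg : HasFDerivAt (fun y : Space => ((a * h y, y) : Spacetime)) _ x :=
    (h0.const_mul a).prodMk (hasFDerivAt_id x)
  have h1 : HasFDerivAt (fun y => j (a * h y, y)) _ x :=
    HasFDerivAt.comp (g := j) x (hj (a * h x, x)).hasFDerivAt hg
  have h2 : HasFDerivAt (fun y => ((b * h y : ℝ) : ℂ)) _ x :=
    Complex.ofRealCLM.hasFDerivAt.comp x (h0.const_mul b)
  have h3 : HasFDerivAt (fun y => ((b * h y : ℝ) : ℂ) * j (a * h y, y)) _ x := h2.mul h1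
  rw [spacePartial, h3.fderiv]
  have : ((a * spacePartial i h x, EuclideanSpace.single i 1) : Spacetime) =
      (a * spacePartial i h x) • (1, 0) + (0, EuclideanSpace.single i 1) := by simp
  simp only [_root_.add_apply, _root_.smul_apply, ContinuousLinearMap.comp_apply, smul_eq_mul,
    ContinuousLinearMap.prod_apply, ContinuousLinearMap.coe_id', id_eq, Complex.ofRealCLM_apply]
  rw [show fderiv ℝ h x (EuclideanSpace.single i 1) = spacePartial i h x from rfl, this, map_add,
    map_smul, Complex.real_smul]
  push_cast
  ring

/-- The graphs of sin(l)·h deform the zero slice (l = 0) into the graph of h (l = π/2), and the flux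
has zero derivative in l. Since |sin(l) h| ≤ |h| for every real l, one radius R bounds all supports,
and the constancy argument runs on the whole line. -/
theorem IsDiracMatrices.scalarProduct_eq_zero_slice (hγ : IsDiracMatrices γ)
    (hh : ContDiff ℝ ∞ h) (ht : IsTransversalToCones h)
    (h₁ : ζ₁ ∈ diracSolutions γ m) (h₂ : ζ₂ ∈ diracSolutions γ m) :
    scalarProduct γ h ζ₁ ζ₂ = scalarProduct γ (fun _ => 0) ζ₁ ζ₂ := by
  obtain ⟨C, hC⟩ := h₂.2.1.exists_bound
  obtain ⟨R, hR⟩ := ht C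
  set j : Fin 4 → Spacetime → ℂ := current γ ζ₁ ζ₂ with hjdef
  have hj : ∀ μ, ContDiff ℝ ∞ (j μ) := fun μ => contDiff_current h₁.1 h₂.1 μ
  have hjd : ∀ μ, Differentiable ℝ (j μ) := fun μ => (hj μ).differentiable (by simp)
  have hhd : Differentiable ℝ h := hh.differentiable (by simp)
  have hj0 : ∀ μ l x, R < ‖x‖ → j μ (Real.sin l * h x, x) = 0 := by
    intro μ l x hx
    have : ζ₂ (Real.sin l * h x, x) = 0 := by
      by_contra hne
      refine absurd (hR x ((hC _ hne).trans ?_)) (not_le.2 hx)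
      have : |Real.sin l * h x| ≤ |h x| := by
        rw [abs_mul]
        exact mul_le_of_le_one_left (abs_nonneg _) (Real.abs_sin_le_one l)
      simpa using this
    simp [hjdef, current, this]
  have hpart : ∀ i, ContDiff ℝ 1 (spacePartial i h) := fun i =>
    ((contDiff_infty_iff_fderiv.1 hh).2.clm_apply contDiff_const).of_le (by norm_cast)
  set F : Spacetime → ℂ := fun p => j 0 (Real.sin p.1 * h p.2, p.2) -
    ∑ i : Fin 3, ((Real.sin p.1 * spacePartial i h p.2 : ℝ) : ℂ) *
      j i.succ (Real.sin p.1 * h p.2, p.2) with hFdef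
  have hsin : ContDiff ℝ 1 fun p : Spacetime => Real.sin p.1 := Real.contDiff_sin.comp contDiff_fst
  have hgraph : ContDiff ℝ 1 fun p : Spacetime => ((Real.sin p.1 * h p.2, p.2) : Spacetime) :=
    (hsin.mul ((hh.of_le (by norm_cast)).comp contDiff_snd)).prodMk contDiff_snd
  have hF : ContDiff ℝ 1 F := by
    refine (((hj 0).of_le (by norm_cast)).comp hgraph).sub (ContDiff.sum fun i _ => ?_)
    exact (Complex.ofRealCLM.contDiff.comp (hsin.mul ((hpart i).comp contDiff_snd))).mul
      (((hj i.succ).of_le (by norm_cast)).comp hgraph)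
  have hF0 : ∀ l x, R < ‖x‖ → F (l, x) = 0 := fun l x hx => by
    simp [hFdef, hj0 _ l x hx]
  set G : ℝ → Fin 3 → Space → ℂ := fun l i y =>
    ((Real.cos l * h y : ℝ) : ℂ) * j i.succ (Real.sin l * h y, y) with hGdef
  have hG : ∀ l i, ContDiff ℝ 1 (G l i) := by
    intro l i
    have h1 : ContDiff ℝ 1 fun y => ((Real.sin l * h y, y) : Spacetime) :=
      (contDiff_const.mul (hh.of_le (by norm_cast))).prodMk contDiff_id
    exact (Complex.ofRealCLM.contDiff.comp (contDiff_const.mul (hh.of_le (by norm_cast)))).mul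
      (((hj i.succ).of_le (by norm_cast)).comp h1)
  have hGc : ∀ l i, HasCompactSupport (G l i) := fun l i =>
    hasCompactSupport_of_eq_zero_of_lt (R := R) fun y hy => by simp [hGdef, hj0 _ l y hy]
  -- Replacing ∂₀j⁰ by −∂_i j^i makes the derivative of the flux density minus the divergence of
  -- cos(l) h j^i along the graph.
  have hdF : ∀ l x, fderiv ℝ F (l, x) (1, 0) = -∑ i, spacePartial i (G l i) x := by
    intro l x
    have hd1 := hasDerivAt_slice hF l x
    have hd2 : HasDerivAt (fun l => F (l, x)) _ l :=
      (hasDerivAt_comp_graph (hjd 0) x (h x) l).sub (HasDerivAt.fun_sum fun i _ =>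
        ((((Real.hasDerivAt_sin l).mul_const (spacePartial i h x)).ofReal_comp).mul
          (hasDerivAt_comp_graph (hjd (Fin.succ i)) x (h x) l)))
    have hcons := hγ.sum_partialDeriv_current (h₁.1.differentiable (by simp))
      (h₂.1.differentiable (by simp)) (h₁.2.2 (Real.sin l * h x, x)) (h₂.2.2 (Real.sin l * h x, x))
    rw [sum_partialDeriv_eq] at hcons
    rw [hd1.unique hd2, eq_neg_of_add_eq_zero_left hcons]
    simp only [hGdef, spacePartial_mul_comp_graph (hjd _) hhd]
    rw [mul_neg, Finset.mul_sum, ← Finset.sum_neg_distrib, ← Finset.sum_neg_distrib,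
      ← Finset.sum_sub_distrib]
    refine Finset.sum_congr rfl fun i _ => ?_
    push_cast
    ring
  have hderiv : ∀ l, HasDerivAt (fun l => ∫ x, F (l, x)) 0 l := by
    intro l
    have hd := hasDerivAt_integral_slice hF (t₀ := l) (R := R) fun t _ x hx => hF0 t x hx
    refine hd.congr_deriv ?_
    simp only [hdF]
    rw [integral_neg, integral_finsetSum]
    · simp [integral_spacePartial_eq_zero (hG l _) (hGc l _)]
    · intro i _
      have hc : Continuous fun x => spacePartial i (G l i) x := by
        have := (hG l i).continuous_fderiv one_ne_zero
        unfold spacePartial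
        fun_prop
      exact hc.integrable_of_hasCompactSupport ((hGc l i).fderiv_apply ℝ _)
  have hconst := is_const_of_deriv_eq_zero (fun l => (hderiv l).differentiableAt)
    (fun l => (hderiv l).deriv) (Real.pi / 2) 0
  have e1 : ∀ x, F (Real.pi / 2, x) = fluxDensity γ h ζ₁ ζ₂ x := fun x => by
    simp [hFdef, fluxDensity, hjdef]
  have e2 : ∀ x, F (0, x) = fluxDensity γ (fun _ => 0) ζ₁ ζ₂ x := fun x => by
    simp [hFdef, fluxDensity, hjdef, spacePartial]
  simpa only [e1, e2, scalarProduct] using hconst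

theorem IsDiracMatrices.scalarProduct_const (hγ : IsDiracMatrices γ) (s : ℝ) :
    scalarProduct γ (fun _ => s) ζ₁ ζ₂ = ∫ x, star (ζ₁ (s, x)) ⬝ᵥ ζ₂ (s, x) := by
  simp [scalarProduct, fluxDensity, spacePartial, current, hγ.zero_mul_zero]

end

/-! ### Cauchy hypersurfaces -/

section

variable {h : Space → ℝ}

/-- A hypersurface met by all causal curves does not approach a light cone from above. -/
theorem exists_radius_of_meets (hL : LipschitzWith 1 h)
    (hmeet : ∀ c : ℝ → Space, LipschitzWith 1 c → ∃ t : ℝ, h (c t) = t) (C : ℝ) :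
    ∃ R : ℝ, ∀ x, ‖x‖ ≤ h x + C → ‖x‖ ≤ R := by
  by_contra! hcon
  choose x hx1 hx2 using fun n : ℕ => hcon n
  set e : ℕ → Space := fun n => ‖x n‖⁻¹ • x n with he
  have hpos : ∀ n, 0 < ‖x n‖ := fun n => (Nat.cast_nonneg n).trans_lt (hx2 n)
  have hen : ∀ n, e n ∈ Metric.sphere (0 : Space) 1 := fun n => by
    rw [mem_sphere_zero_iff_norm, he, norm_smul, norm_inv, norm_norm,
      inv_mul_cancel₀ (hpos n).ne']
  obtain ⟨a, ha, φ, hφ, hlim⟩ := (isCompact_sphere (0 : Space) 1).tendsto_subseq hen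
  -- As h is 1-Lipschitz, the lower bound at the far point x_n propagates inward along its ray: h(r
  -- e_n) ≥ h(x_n) − (|x_n| − r) ≥ r − C. Passing to the limiting direction `a` gives the bound on a
  -- whole ray.
  have hray : ∀ r : ℝ, 0 ≤ r → r - C ≤ h (r • a) := by
    intro r hr
    have hl : Tendsto (fun n => h (r • e (φ n))) atTop (𝓝 (h (r • a))) :=
      (hL.continuous.tendsto _).comp (hlim.const_smul r)
    refine ge_of_tendsto hl ?_
    filter_upwards [eventually_ge_atTop ⌈r⌉₊] with n hn
    have hrn : r ≤ ‖x (φ n)‖ := by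
      have h1 : (⌈r⌉₊ : ℝ) ≤ (φ n : ℝ) := by exact_mod_cast hn.trans (hφ.id_le n)
      exact ((Nat.le_ceil r).trans h1).trans (hx2 (φ n)).le
    have hd : dist (h (x (φ n))) (h (r • e (φ n))) ≤ ‖x (φ n)‖ - r := by
      refine (hL.dist_le_mul _ _).trans ?_
      have : x (φ n) - r • e (φ n) = ((‖x (φ n)‖ - r) * ‖x (φ n)‖⁻¹) • x (φ n) := by
        rw [he, sub_mul, mul_inv_cancel₀ (hpos _).ne', sub_smul, one_smul, smul_smul]
      rw [NNReal.coe_one, one_mul, dist_eq_norm, this, norm_smul, norm_mul, norm_inv, norm_norm,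
        mul_assoc, inv_mul_cancel₀ (hpos _).ne', mul_one, Real.norm_of_nonneg (by linarith)]
    have h2 := hx1 (φ n)
    rw [Real.dist_eq] at hd
    linarith [le_abs_self (h (x (φ n)) - h (r • e (φ n)))]
  -- This causal curve runs out along `a` at the speed of light, with radius r ≥ t + C + 1. There h
  -- ≥ r − C ≥ t + 1, so it never meets the graph.
  have hc : LipschitzWith 1 fun t : ℝ => max (t + (C + 1)) 0 • a := by
    refine LipschitzWith.of_dist_le_mul fun t s => ?_
    have hna : ‖a‖ = 1 := by simpa using ha
    rw [dist_eq_norm, ← sub_smul, norm_smul, hna, mul_one, NNReal.coe_one, one_mul, Real.dist_eq]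
    have := abs_max_sub_max_le_abs (t + (C + 1)) (s + (C + 1)) 0
    simpa using this
  obtain ⟨t, ht⟩ := hmeet _ hc
  have h1 := hray (max (t + (C + 1)) 0) (le_max_right _ _)
  have h2 := le_max_left (t + (C + 1)) 0
  linarith

theorem IsCauchyHypersurface.isTransversalToCones (hh : IsCauchyHypersurface h) :
    IsTransversalToCones h := by
  have hL : LipschitzWith 1 h :=
    lipschitzWith_of_nnnorm_fderiv_le (𝕜 := ℝ) (hh.smooth.differentiable (by simp))
      fun x => (hh.spacelike x).le
  have hmeet : ∀ c : ℝ → Space, LipschitzWith 1 c → ∃ t : ℝ, h (c t) = t :=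
    fun c hc => (hh.meets c hc).exists
  -- Reversing time along the curves exchanges h and −h, so the past cone follows from the future
  -- one.
  have hmeet' : ∀ c : ℝ → Space, LipschitzWith 1 c → ∃ t : ℝ, -h (c t) = t := by
    intro c hc
    have hc' : LipschitzWith 1 fun t => c (-t) := by
      refine LipschitzWith.of_dist_le_mul fun t s => (hc.dist_le_mul _ _).trans ?_
      rw [dist_neg_neg]
    obtain ⟨s, hs⟩ := hmeet _ hc'
    exact ⟨-s, by rw [hs]⟩
  intro C
  obtain ⟨R₁, h₁⟩ := exists_radius_of_meets hL hmeet C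
  obtain ⟨R₂, h₂⟩ := exists_radius_of_meets hL.neg hmeet' C
  refine ⟨max R₁ R₂, fun x hx => ?_⟩
  rcases abs_cases (h x) with ⟨habs, -⟩ | ⟨habs, -⟩ <;> rw [habs] at hx
  · exact (h₁ x hx).trans (le_max_left _ _)
  · exact (h₂ x hx).trans (le_max_right _ _)

end

/-! ### Scalar products of the solutions `S * f` -/

section

variable {γ : Fin 4 → Matrix (Fin 4) (Fin 4) ℂ} {m : ℝ} {f f₁ f₂ : Spacetime → Spinor}

theorem integrable_waveField_dirac (hf : ContDiff ℝ ∞ f) (hc : HasCompactSupport f)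
    (p : Spacetime) : Integrable fun s => waveField γ m (Measure.dirac s) f p := by
  have h1 := (hasMoments_waveAmplitude (γ := γ) (m := m) (ν := volume) hf hc
    abs_sign_le.1).integrable_wave p
  have h2 := (hasMoments_waveAmplitude (γ := γ) (m := m) (ν := volume) hf hc
    abs_sign_le.2).integrable_wave p
  simp only [waveField, planeWaves_dirac hf hc abs_sign_le.1, planeWaves_dirac hf hc abs_sign_le.2]
  exact h1.integral_prod_left.add h2.integral_prod_left

/-- The phases have modulus one, so the integral of the amplitude norms over k bounds the field
uniformly in spacetime. This provides the majorant for exchanging integrals over emission time and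
space. -/
theorem exists_norm_waveField_dirac_le (γ : Fin 4 → Matrix (Fin 4) (Fin 4) ℂ) (m : ℝ)
    (hf : ContDiff ℝ ∞ f) (hc : HasCompactSupport f) :
    ∃ w : ℝ → ℝ, Integrable w ∧ ∀ s p, ‖waveField γ m (Measure.dirac s) f p‖ ≤ w s := by
  have h1 := (hasMoments_waveAmplitude (γ := γ) (m := m) (ν := volume) hf hc
    abs_sign_le.1).integrable.norm.integral_prod_left
  have h2 := (hasMoments_waveAmplitude (γ := γ) (m := m) (ν := volume) hf hc
    abs_sign_le.2).integrable.norm.integral_prod_left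
  refine ⟨_, h1.add h2, fun s p => ?_⟩
  rw [waveField, planeWaves_dirac hf hc abs_sign_le.1, planeWaves_dirac hf hc abs_sign_le.2]
  refine (norm_add_le _ _).trans (add_le_add ?_ ?_) <;>
  · refine (norm_integral_le_integral_norm _).trans (le_of_eq ?_)
    simp only [norm_smul, norm_exp_I_mul, one_mul]

theorem stronglyMeasurable_waveField_dirac (hf : ContDiff ℝ ∞ f) (hc : HasCompactSupport f)
    (t : ℝ) : StronglyMeasurable fun z : Space × ℝ =>
      waveField γ m (Measure.dirac z.2) f (t, z.1) := by
  have key : ∀ σ : ℝ, StronglyMeasurable fun z : Space × ℝ =>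
      ∫ k, Complex.exp (Complex.I * ((waveCovector m σ k (t, z.1) : ℝ) : ℂ)) •
        waveAmplitude γ m σ f (z.2, k) := by
    intro σ
    have h1 : Continuous fun w : (Space × ℝ) × Space =>
        Complex.exp (Complex.I * ((waveCovector m σ w.2 (t, w.1.1) : ℝ) : ℂ)) := by
      have := continuous_waveCovector (m := m) (σ := σ)
      fun_prop
    have h2 : Measurable fun w : (Space × ℝ) × Space => waveAmplitude γ m σ f (w.1.2, w.2) :=
      (measurable_waveAmplitude hf.continuous).comp (by fun_prop)
    exact (h1.stronglyMeasurable.smul h2.stronglyMeasurable).integral_prod_right' (ν := volume)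
  simp only [waveField, planeWaves_dirac hf hc abs_sign_le.1, planeWaves_dirac hf hc abs_sign_le.2]
  exact (key 1).add (key (-1))

theorem star_dotProduct_eq_pairing (u v : Spinor) : star u ⬝ᵥ v = pairing 1 u v := by
  rw [pairing_apply, Matrix.one_mulVec]

theorem integrable_star_dotProduct_propagatorConv (hγ : IsDiracMatrices γ)
    (hf₁ : ContDiff ℝ ∞ f₁) (hc₁ : HasCompactSupport f₁)
    (hf₂ : ContDiff ℝ ∞ f₂) (hc₂ : HasCompactSupport f₂) :
    Integrable fun x => star (f₁ x) ⬝ᵥ (γ 0 *ᵥ propagatorConv γ m f₂ x) := by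
  have h1 := hf₁.continuous
  have h2 : Continuous (propagatorConv γ m f₂) := (hγ.propagatorConv_mem hf₂ hc₂).1.continuous
  have hcont : Continuous fun x => pairing (γ 0) (f₁ x) (propagatorConv γ m f₂ x) := by
    fun_prop
  refine hcont.integrable_of_hasCompactSupport (hc₁.mono fun x hx => ?_)
  contrapose! hx
  rw [Function.notMem_support] at hx
  simp [hx]

theorem IsDiracMatrices.scalarProduct_propagatorConv (hγ : IsDiracMatrices γ)
    (hf₁ : ContDiff ℝ ∞ f₁) (hc₁ : HasCompactSupport f₁)
    (hf₂ : ContDiff ℝ ∞ f₂) (hc₂ : HasCompactSupport f₂) {h : Space → ℝ}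
    (hh : ContDiff ℝ ∞ h) (ht : IsTransversalToCones h) :
    scalarProduct γ h (propagatorConv γ m f₁) (propagatorConv γ m f₂) =
      -Complex.I * ∫ x, star (f₁ x) ⬝ᵥ (γ 0 *ᵥ propagatorConv γ m f₂ x) := by
  have m₁ := hγ.propagatorConv_mem (m := m) hf₁ hc₁
  have m₂ := hγ.propagatorConv_mem (m := m) hf₂ hc₂
  have mw := fun s => hγ.waveField_dirac_mem (m := m) hf₁ hc₁ s
  set ψ := propagatorConv γ m f₂ with hψ
  -- The product is carried from time 0 to the emission time s, where the first factor is iβf₁(s,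
  -- ·); conjugating i gives the factor −i.
  have hslice : ∀ s, ∫ x, star (waveField γ m (Measure.dirac s) f₁ (0, x)) ⬝ᵥ ψ (0, x) =
      -Complex.I * ∫ x, star (f₁ (s, x)) ⬝ᵥ (γ 0 *ᵥ ψ (s, x)) := by
    intro s
    rw [← hγ.scalarProduct_const, ← hγ.scalarProduct_eq_zero_slice contDiff_const
      (isTransversalToCones_const s) (mw s) m₂, hγ.scalarProduct_const, ← integral_const_mul]
    refine integral_congr_ae (Eventually.of_forall fun x => ?_)
    simp only [waveField_dirac_self hf₁ hc₁, star_smul, smul_dotProduct,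
      star_mulVec_dotProduct hγ.herm_zero, Complex.star_def, Complex.conj_I, smul_eq_mul]
  have hinner : ∀ x, star (propagatorConv γ m f₁ (0, x)) ⬝ᵥ ψ (0, x) =
      ∫ s, star (waveField γ m (Measure.dirac s) f₁ (0, x)) ⬝ᵥ ψ (0, x) := by
    intro x
    have := ((pairing 1).flip (ψ (0, x))).integral_comp_comm
      (integrable_waveField_dirac (γ := γ) (m := m) hf₁ hc₁ (0, x))
    simp only [ContinuousLinearMap.flip_apply] at this
    simp only [star_dotProduct_eq_pairing]
    rw [this, propagatorConv_eq_waveField hf₁ hc₁, waveField_volume hf₁ hc₁]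
  rw [hγ.scalarProduct_eq_zero_slice hh ht m₁ m₂, hγ.scalarProduct_const]
  simp only [hinner]
  rw [integral_integral_swap]
  · simp only [hslice]
    rw [integral_const_mul, Measure.volume_eq_prod,
      integral_prod _ (integrable_star_dotProduct_propagatorConv hγ hf₁ hc₁ hf₂ hc₂)]
  -- Fubini: the integrand is dominated by a multiple of w(s)|ψ(0, x)|, where ψ(0, ·) has compact
  -- support.
  · obtain ⟨w, hw, hwb⟩ := exists_norm_waveField_dirac_le γ m hf₁ hc₁
    obtain ⟨C, hC⟩ := m₂.2.1.exists_bound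
    have hψc : Continuous fun x : Space => ψ (0, x) := m₂.1.continuous.comp (by fun_prop)
    have hψi : Integrable fun x : Space => ψ (0, x) :=
      integrable_of_eq_zero_of_lt (R := C) hψc fun x hx => by
        by_contra hne
        have := hC _ hne
        simp only [abs_zero, zero_add] at this
        exact absurd this (not_le.2 hx)
    have hmeas : AEStronglyMeasurable (fun z : Space × ℝ =>
        pairing 1 (waveField γ m (Measure.dirac z.2) f₁ (0, z.1)) (ψ (0, z.1)))
        (volume.prod volume) := by
      have hp : Continuous fun u : Spinor × Spinor => pairing 1 u.1 u.2 :=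
        (pairing 1).continuous₂
      exact (hp.comp_stronglyMeasurable ((stronglyMeasurable_waveField_dirac hf₁ hc₁ 0).prodMk
        ((hψc.comp continuous_fst).stronglyMeasurable))).aestronglyMeasurable
    have hint := ((hψi.norm.mul_prod hw).const_mul ‖pairing 1‖).mono' hmeas
      (Eventually.of_forall fun z => by
        refine ((pairing 1).le_opNorm₂ _ _).trans ?_
        rw [mul_assoc, mul_comm ‖ψ _‖]
        gcongr
        exact hwb _ _)
    exact hint.congr (Eventually.of_forall fun z => (star_dotProduct_eq_pairing _ _).symm)

/-- A point of supp f₁ in the shadow of supp f₂ would, by symmetry of causal relatedness, put a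
point of supp f₂ in the shadow of supp f₁. -/
theorem IsDiracMatrices.integral_eq_zero_of_spatiallySeparated (hγ : IsDiracMatrices γ)
    (hf₂ : ContDiff ℝ ∞ f₂) (hc₂ : HasCompactSupport f₂)
    (hsep : SpatiallySeparated (tsupport f₁) (tsupport f₂)) :
    ∫ x, star (f₁ x) ⬝ᵥ (γ 0 *ᵥ propagatorConv γ m f₂ x) = 0 := by
  refine integral_eq_zero_of_ae (Eventually.of_forall fun x => ?_)
  by_cases h1 : f₁ x = 0
  · simp [h1]
  by_cases h2 : propagatorConv γ m f₂ x = 0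
  · simp [h2]
  exfalso
  obtain ⟨q, hq, hle⟩ := (mem_causalShadow_iff _ _).1
    (hγ.mem_causalShadow_of_propagatorConv_ne_zero hf₂ hc₂ h2)
  refine Set.disjoint_left.1 hsep ((mem_causalShadow_iff _ _).2 ⟨x, subset_tsupport _ h1, ?_⟩) hq
  rwa [norm_sub_rev, abs_sub_comm]

end

end DiracCauchy

end

/-- The integrability clauses ensure that neither side of the scalar product formula is a default
value 0. -/
theorem mainTheorem11 (m : ℝ) (hm : 0 ≤ m) (γ : Fin 4 → Matrix (Fin 4) (Fin 4) ℂ)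
    (hγ : DiracCauchy.IsDiracMatrices γ) :
    -- the Cauchy problem
    (∀ ϑ : DiracCauchy.Space → DiracCauchy.Spinor, ContDiff ℝ ∞ ϑ → HasCompactSupport ϑ →
      (∃! ζ : DiracCauchy.Spacetime → DiracCauchy.Spinor,
        ζ ∈ DiracCauchy.diracSolutions γ m ∧ ∀ x, ζ (0, x) = ϑ x) ∧
      ∀ ζ : DiracCauchy.Spacetime → DiracCauchy.Spinor,
        ζ ∈ DiracCauchy.diracSolutions γ m → (∀ x, ζ (0, x) = ϑ x) →
          tsupport ζ ⊆ DiracCauchy.causalShadow ({(0 : ℝ)} ×ˢ tsupport ϑ) ∧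
          ∀ (t : ℝ) (x : DiracCauchy.Space), ζ (t, x) =
            (-Complex.I) • DiracCauchy.propagatorSpaceConv γ m t (fun y => γ 0 *ᵥ ϑ y) x) ∧
    -- solutions of the form `S * f`
    (∀ f : DiracCauchy.Spacetime → DiracCauchy.Spinor, ContDiff ℝ ∞ f → HasCompactSupport f →
      DiracCauchy.propagatorConv γ m f ∈ DiracCauchy.diracSolutions γ m) ∧
    (∀ ζ ∈ DiracCauchy.diracSolutions γ m,
      ∃ f : DiracCauchy.Spacetime → DiracCauchy.Spinor, ContDiff ℝ ∞ f ∧ HasCompactSupport f ∧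
        ζ = DiracCauchy.propagatorConv γ m f) ∧
    -- their scalar products, computed on any Cauchy hypersurface
    (∀ f₁ f₂ : DiracCauchy.Spacetime → DiracCauchy.Spinor,
      ContDiff ℝ ∞ f₁ → HasCompactSupport f₁ → ContDiff ℝ ∞ f₂ → HasCompactSupport f₂ →
      MeasureTheory.Integrable
        (fun x => star (f₁ x) ⬝ᵥ (γ 0 *ᵥ DiracCauchy.propagatorConv γ m f₂ x)) ∧
      ∀ h : DiracCauchy.Space → ℝ, DiracCauchy.IsCauchyHypersurface h →
        MeasureTheory.Integrable (DiracCauchy.fluxDensity γ h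
          (DiracCauchy.propagatorConv γ m f₁) (DiracCauchy.propagatorConv γ m f₂)) ∧
        DiracCauchy.scalarProduct γ h
            (DiracCauchy.propagatorConv γ m f₁) (DiracCauchy.propagatorConv γ m f₂) =
          -Complex.I *
            ∫ x, star (f₁ x) ⬝ᵥ (γ 0 *ᵥ DiracCauchy.propagatorConv γ m f₂ x) ∧
        (DiracCauchy.SpatiallySeparated (tsupport f₁) (tsupport f₂) →
          DiracCauchy.scalarProduct γ h
            (DiracCauchy.propagatorConv γ m f₁) (DiracCauchy.propagatorConv γ m f₂) = 0)) := by
  refine ⟨fun ϑ hϑ hc => hγ.cauchy_problem hϑ hc, fun f hf hc => hγ.propagatorConv_mem hf hc,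
    fun ζ hζ => hγ.exists_source hζ, fun f₁ f₂ hf₁ hc₁ hf₂ hc₂ =>
      ⟨DiracCauchy.integrable_star_dotProduct_propagatorConv hγ hf₁ hc₁ hf₂ hc₂, fun h hh => ?_⟩⟩
  have ht := hh.isTransversalToCones
  have hsp := hγ.scalarProduct_propagatorConv (m := m) hf₁ hc₁ hf₂ hc₂ hh.smooth ht
  refine ⟨DiracCauchy.integrable_fluxDensity hh.smooth ht (hγ.propagatorConv_mem hf₁ hc₁)
    (hγ.propagatorConv_mem hf₂ hc₂), hsp, fun hsep => ?_⟩
  rw [hsp, hγ.integral_eq_zero_of_spatiallySeparated hf₂ hc₂ hsep, mul_zero]
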